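/- Let $M$ be a smooth manifold of dimension $4n$ with a smooth $\mathrm{Sp}(1)\mathrm{GL}(n,\mathbb H)$-structure $Q$ that admits a smooth torsion-free connection (a quaternionic manifold). Here $\mathrm{Sp}(1)\mathrm{GL}(n,\mathbb H)$ is the group of real-linear automorphisms $v\mapsto qA(v)$ of the left $\mathbb H$-module $\mathbb H^n$, with $q$ a unit quaternion and $A$ an $\mathbb H$-linear automorphism, and $Q$ is a principal subbundle, with this structure group, of the bundle of frames $u:\mathbb H^n\to T_xM$ (real-linear isomorphisms). A frame $u\in Q_x$ transports left multiplication by the imaginary quaternions to $T_xM$, and so gives an action of $\mathfrak{sp}(1)=\langle I,J,K\rangle$ on the space $\Lambda^kT_x^*M$ of complex-valued $k$-covectors (the dual action on covectors, extended by the Leibniz rule). Let $V_r$ be the irreducible complex representation of $\mathrm{Sp}(1)$ with highest weight $r$, let $(E_{k,r})_x\subseteq\Lambda^kT_x^*M$ be the sum of all irreducible subrepresentations isomorphic to $V_r$ (so $E_{k,r}=0$ for $r<0$), and let $\mathcal C=I^2+J^2+K^2$ be the Casimir operator; neither depends on the choice of $u\in Q_x$. Then $\Lambda^{k+1}T_x^*M=\bigoplus_{s}(E_{k+1,s})_x$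 for every $x\in M$; let $\pi_{k+1,s}$ be the projection onto $E_{k+1,s}$ along the other summands. For sections $\alpha$ of $E_{k,r}$ put $$\mathcal D\alpha=\pi_{k+1,r+1}(d\alpha),\qquad \overline{\mathcal D}\alpha=\pi_{k+1,r-1}(d\alpha).$$ Let $k,r\ge 0$ be integers and let $\alpha$ be a smooth complex-valued (in particular, possibly real-valued) $k$-form on $M$ that is a section of $E_{k,r}$. Then $$\mathcal D\alpha=-\frac14\left((r-1)+\frac1{r+1}(I^2+J^2+K^2)\right)d\alpha \qquad\text{and}\qquad \overline{\mathcal D}\alpha=\frac14\left((r+3)+\frac1{r+1}(I^2+J^2+K^2)\right)d\alpha .$$ -/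

import Mathlib

open scoped Manifold ContDiff Quaternion Topology

noncomputable section

namespace QuaternionicForms

/-! ### The model: `ℍⁿ` and the group `Sp(1)GL(n,ℍ)` -/

/-- The space `ℍⁿ`, a left `ℍ`-module by `(q • v) i = q * v i`. -/
abbrev HSpace (n : ℕ) : Type := Fin n → ℍ[ℝ]

/-- Membership in `Sp(1)GL(n,ℍ)`: the real-linear automorphisms `v ↦ q • A v` of `ℍⁿ`, with `q` a
unit quaternion and `A` an automorphism of the left `ℍ`-module `ℍⁿ` (that is, right multiplication
of row vectors by an invertible quaternionic matrix). -/
def IsSpGL {n : ℕ} (g : HSpace n ≃L[ℝ] HSpace n) : Prop :=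
  ∃ q : ℍ[ℝ], ‖q‖ = 1 ∧ ∃ A : HSpace n ≃ₗ[ℍ[ℝ]] HSpace n, ∀ v, g v = q • A v

/-- Membership in the Lie algebra `𝔰𝔭(1) + 𝔤𝔩(n,ℍ)` of `Sp(1)GL(n,ℍ)`: the real-linear maps
`v ↦ p • v + A v`, with `p` an imaginary quaternion and `A` left `ℍ`-linear. -/
def IsSpGLAlgebra {n : ℕ} (B : HSpace n → HSpace n) : Prop :=
  ∃ p : ℍ[ℝ], p.re = 0 ∧ ∃ A : HSpace n →ₗ[ℍ[ℝ]] HSpace n, ∀ v, B v = p • v + A v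

/-- Multiplication by `p` on the left of `ℍⁿ`, as a continuous real-linear map. -/
def leftMul (n : ℕ) (p : ℍ[ℝ]) : HSpace n →L[ℝ] HSpace n :=
  LinearMap.toContinuousLinearMap
    { toFun := fun v => p • v
      map_add' := fun v w => smul_add p v w
      map_smul' := fun c v => smul_comm p c v }

/-! ### The action of `𝔰𝔭(1)` on exterior forms on one vector space -/

section Fibre

variable {V : Type*} [AddCommGroup V] [Module ℝ V] [TopologicalSpace V] {n k : ℕ}

/-- The underlying multilinear form of the action of an endomorphism on an alternating form. -/
def formActionAux (A : V →L[ℝ] V) (β : V [⋀^Fin k]→L[ℝ] ℂ) :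
    ContinuousMultilinearMap ℝ (fun _ : Fin k => V) ℂ :=
  -∑ j : Fin k, β.toContinuousMultilinearMap.compContinuousLinearMap
    (fun i => if i = j then A else ContinuousLinearMap.id ℝ V)

theorem formActionAux_apply (A : V →L[ℝ] V) (β : V [⋀^Fin k]→L[ℝ] ℂ) (v : Fin k → V) :
    formActionAux A β v = -∑ j : Fin k, β (Function.update v j (A (v j))) := by
  simp only [formActionAux, neg_apply, sum_apply,
    ContinuousMultilinearMap.compContinuousLinearMap_apply,
    ContinuousAlternatingMap.coe_toContinuousMultilinearMap]
  congr 1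
  refine Finset.sum_congr rfl fun j _ => ?_
  congr 1
  funext i
  by_cases h : i = j
  · subst h; simp
  · simp [h]

theorem formActionAux_alternating (A : V →L[ℝ] V) (β : V [⋀^Fin k]→L[ℝ] ℂ) (v : Fin k → V)
    (a b : Fin k) (hv : v a = v b) (hab : a ≠ b) : formActionAux A β v = 0 := by
  rw [formActionAux_apply, neg_eq_zero,
    ← Finset.add_sum_erase _ _ (Finset.mem_univ a),
    ← Finset.add_sum_erase _ _ (Finset.mem_erase.2 ⟨hab.symm, Finset.mem_univ b⟩),
    Finset.sum_eq_zero, add_zero]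
  · have h : Function.update v b (A (v b)) =
        Function.update v a (A (v a)) ∘ Equiv.swap a b := by
      funext i
      by_cases hia : i = a
      · subst hia; simp [Function.update_of_ne hab, Function.update_of_ne hab.symm, hv]
      · by_cases hib : i = b
        · subst hib; simp [hv]
        · simp [Equiv.swap_apply_of_ne_of_ne hia hib, hia, hib]
    rw [h]
    have := β.toAlternatingMap.map_swap (Function.update v a (A (v a))) hab
    simp only [ContinuousAlternatingMap.coe_toAlternatingMap] at this
    rw [this, add_neg_cancel]
  · intro j hj
    simp only [Finset.mem_erase, Finset.mem_univ, and_true] at hj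
    refine β.map_eq_zero_of_eq _ ?_ hab
    rw [Function.update_of_ne hj.2.symm, Function.update_of_ne hj.1.symm, hv]

/-- The action of an endomorphism `A` of `V` on complex-valued alternating `k`-forms,
`(A β)(v₁, …, v_k) = - ∑ j, β(v₁, …, A v_j, …, v_k)`: the dual action on covectors, extended to
forms by the Leibniz rule. -/
def formAction (A : V →L[ℝ] V) :
    (V [⋀^Fin k]→L[ℝ] ℂ) →ₗ[ℂ] (V [⋀^Fin k]→L[ℝ] ℂ) where
  toFun β :=
    { toContinuousMultilinearMap := formActionAux A β
      map_eq_zero_of_eq' := fun v a b hv hab => formActionAux_alternating A β v a b hv hab }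
  map_add' β γ := by
    ext v
    change formActionAux A (β + γ) v = formActionAux A β v + formActionAux A γ v
    simp only [formActionAux_apply, ContinuousAlternatingMap.add_apply, Finset.sum_add_distrib,
      neg_add]
  map_smul' c β := by
    ext v
    change formActionAux A (c • β) v = c • formActionAux A β v
    simp only [formActionAux_apply, ContinuousAlternatingMap.smul_apply, smul_neg,
      Finset.smul_sum]

theorem formAction_apply (A : V →L[ℝ] V) (β : V [⋀^Fin k]→L[ℝ] ℂ) (v : Fin k → V) :
    formAction A β v = -∑ j : Fin k, β (Function.update v j (A (v j))) :=
  formActionAux_apply A β v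

/-- A frame `u : ℍⁿ ≅ V` transports left multiplication by the quaternion `p` to `V`. -/
def quatEnd (u : HSpace n ≃L[ℝ] V) (p : ℍ[ℝ]) : V →L[ℝ] V :=
  (u : HSpace n →L[ℝ] V) ∘L leftMul n p ∘L (u.symm : V →L[ℝ] HSpace n)

/-- The action of the Lie algebra `𝔰𝔭(1)` of imaginary quaternions on `k`-forms on `V`, through a
frame `u`. -/
def sp1Action (u : HSpace n ≃L[ℝ] V) (p : ℍ[ℝ]) :
    (V [⋀^Fin k]→L[ℝ] ℂ) →ₗ[ℂ] (V [⋀^Fin k]→L[ℝ] ℂ) :=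
  formAction (quatEnd u p)

/-- The quaternion unit `i`. -/
def qi : ℍ[ℝ] := ⟨0, 1, 0, 0⟩
/-- The quaternion unit `j`. -/
def qj : ℍ[ℝ] := ⟨0, 0, 1, 0⟩
/-- The quaternion unit `k`. -/
def qk : ℍ[ℝ] := ⟨0, 0, 0, 1⟩

/-- The Casimir operator `I² + J² + K²` on `k`-forms. -/
def casimir (u : HSpace n ≃L[ℝ] V) :
    (V [⋀^Fin k]→L[ℝ] ℂ) →ₗ[ℂ] (V [⋀^Fin k]→L[ℝ] ℂ) :=
  sp1Action u qi ∘ₗ sp1Action u qi + sp1Action u qj ∘ₗ sp1Action u qj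
    + sp1Action u qk ∘ₗ sp1Action u qk

/-- `W` is a subrepresentation. As `Sp(1)` is connected, the subspaces invariant under `Sp(1)` are
those invariant under `𝔰𝔭(1)`. -/
def IsSubrep (u : HSpace n ≃L[ℝ] V) (W : Submodule ℂ (V [⋀^Fin k]→L[ℝ] ℂ)) : Prop :=
  ∀ p : ℍ[ℝ], p.re = 0 → ∀ w ∈ W, sp1Action u p w ∈ W

/-- `W` is an irreducible subrepresentation. -/
def IsIrredSubrep (u : HSpace n ≃L[ℝ] V) (W : Submodule ℂ (V [⋀^Fin k]→L[ℝ] ℂ)) : Prop :=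
  IsSubrep u W ∧ W ≠ ⊥ ∧ ∀ W' ≤ W, IsSubrep u W' → W' = ⊥ ∨ W' = W

/-- The weights of `W`: the integers `m` such that `I` has the eigenvalue `m √-1` on `W`. -/
def weights (u : HSpace n ≃L[ℝ] V) (W : Submodule ℂ (V [⋀^Fin k]→L[ℝ] ℂ)) : Set ℤ :=
  {m | ∃ w ∈ W, w ≠ 0 ∧ sp1Action u qi w = ((m : ℂ) * Complex.I) • w}

/-- The sum of all irreducible subrepresentations with highest weight `r` (those isomorphic to
`V_r`) in the `k`-forms on `V`. It is zero for `r < 0`. -/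
def isotypic (k : ℕ) (r : ℤ) (u : HSpace n ≃L[ℝ] V) : Submodule ℂ (V [⋀^Fin k]→L[ℝ] ℂ) :=
  sSup {W | IsIrredSubrep u W ∧ IsGreatest (weights u W) r}

end Fibre

/-! ### Differential forms on a manifold -/

section Manifold

variable {n k : ℕ} {M : Type*} [TopologicalSpace M]
  [ChartedSpace (EuclideanSpace ℝ (Fin (4 * n))) M]

/-- Complex-valued `k`-covectors at the point `x` of a `4n`-dimensional manifold. -/
abbrev Covector (n k : ℕ) {M : Type*} [TopologicalSpace M]
    [ChartedSpace (EuclideanSpace ℝ (Fin (4 * n))) M] (x : M) : Type :=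
  (TangentSpace (𝓡 (4 * n)) x) [⋀^Fin k]→L[ℝ] ℂ

/-- The expression of a `k`-form in the preferred chart at `x`: its pullback by the inverse chart. -/
def inChart (α : ∀ x : M, Covector n k x) (x : M) (y : EuclideanSpace ℝ (Fin (4 * n))) :
    EuclideanSpace ℝ (Fin (4 * n)) [⋀^Fin k]→L[ℝ] ℂ :=
  (α ((extChartAt (𝓡 (4 * n)) x).symm y)).compContinuousLinearMap
    (mfderiv 𝓘(ℝ, EuclideanSpace ℝ (Fin (4 * n))) (𝓡 (4 * n)) (extChartAt (𝓡 (4 * n)) x).symm y)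

/-- A `k`-form is smooth if its expressions in the charts are. -/
def IsSmoothForm (α : ∀ x : M, Covector n k x) : Prop :=
  ∀ x : M, ContDiffOn ℝ ∞ (inChart α x) (extChartAt (𝓡 (4 * n)) x).target

/-- The exterior derivative on `M`: at `x`, the pullback by the preferred chart at `x` of the
exterior derivative of the expression of `α` in that chart. -/
def extD (α : ∀ x : M, Covector n k x) (x : M) : Covector n (k + 1) x :=
  (extDeriv (inChart α x) (extChartAt (𝓡 (4 * n)) x x)).compContinuousLinearMap
    (mfderiv (𝓡 (4 * n)) 𝓘(ℝ, EuclideanSpace ℝ (Fin (4 * n))) (extChartAt (𝓡 (4 * n)) x) x)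

/-- A field of frames `s` is smooth on `U` if all the vector fields `s v`, `v ∈ ℍⁿ`, are. -/
def IsSmoothFrameOn [IsManifold (𝓡 (4 * n)) ∞ M]
    (s : ∀ x : M, HSpace n ≃L[ℝ] TangentSpace (𝓡 (4 * n)) x) (U : Set M) : Prop :=
  ∀ v : HSpace n, ContMDiffOn (𝓡 (4 * n)) (𝓡 (4 * n)).tangent ∞
    (fun x => (⟨x, s x v⟩ : TangentBundle (𝓡 (4 * n)) M)) U

end Manifold

/-! ### Quaternionic manifolds -/

/-- An `Sp(1)GL(n,ℍ)`-structure on a `4n`-manifold: a principal subbundle, with structure group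
`Sp(1)GL(n,ℍ)`, of the bundle of frames `ℍⁿ ≅ T_x M`. -/
structure SpGLStructure (n : ℕ) (M : Type*) [TopologicalSpace M]
    [ChartedSpace (EuclideanSpace ℝ (Fin (4 * n))) M] [IsManifold (𝓡 (4 * n)) ∞ M] where
  /-- The frames at `x` that belong to the structure. -/
  frames : ∀ x : M, Set (HSpace n ≃L[ℝ] TangentSpace (𝓡 (4 * n)) x)
  /-- The fibre over `x` is an orbit of the group. -/
  mem_frames_iff : ∀ x, ∀ u ∈ frames x, ∀ u' : HSpace n ≃L[ℝ] TangentSpace (𝓡 (4 * n)) x,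
    u' ∈ frames x ↔ ∃ g : HSpace n ≃L[ℝ] HSpace n, IsSpGL g ∧ u' = g.trans u
  /-- There are smooth local sections around every point. -/
  exists_section : ∀ x₀ : M, ∃ U : Set M, IsOpen U ∧ x₀ ∈ U ∧
    ∃ s : ∀ x : M, HSpace n ≃L[ℝ] TangentSpace (𝓡 (4 * n)) x,
      (∀ x ∈ U, s x ∈ frames x) ∧ IsSmoothFrameOn s U

namespace SpGLStructure

variable {n : ℕ} {M : Type*} [TopologicalSpace M]
  [ChartedSpace (EuclideanSpace ℝ (Fin (4 * n))) M] [IsManifold (𝓡 (4 * n)) ∞ M]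

/-- The linear connection `∇` is a connection on the structure `Q`: in every smooth local section
`s` of `Q`, its connection form `X ↦ s⁻¹ ∇_X s` has values in the Lie algebra of
`Sp(1)GL(n,ℍ)`. -/
def IsPreservedBy (Q : SpGLStructure n M)
    (cov : CovariantDerivative (𝓡 (4 * n)) (EuclideanSpace ℝ (Fin (4 * n)))
      (TangentSpace (𝓡 (4 * n)) : M → Type _)) : Prop :=
  ∀ (U : Set M) (s : ∀ x : M, HSpace n ≃L[ℝ] TangentSpace (𝓡 (4 * n)) x),
    IsOpen U → (∀ x ∈ U, s x ∈ Q.frames x) → IsSmoothFrameOn s U →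
    ∀ x ∈ U, ∀ X : TangentSpace (𝓡 (4 * n)) x,
      IsSpGLAlgebra fun v => (s x).symm (cov (fun y => s y v) x X)

/-- `(M, Q)` is a quaternionic manifold: `Q` admits a smooth torsion-free connection. -/
def IsQuaternionic (Q : SpGLStructure n M) : Prop :=
  ∃ cov : CovariantDerivative (𝓡 (4 * n)) (EuclideanSpace ℝ (Fin (4 * n)))
      (TangentSpace (𝓡 (4 * n)) : M → Type _),
    cov.ContMDiffCovariantDerivative ∞ ∧ cov.torsion = 0 ∧ Q.IsPreservedBy cov

/-- The fibre at `x` of the bundle `E_{k,r}`: the `k`-covectors lying in the sum of the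
`Sp(1)`-subrepresentations with highest weight `r`. Two frames of `Q` at `x` give `𝔰𝔭(1)`-actions
which differ by an automorphism of `𝔰𝔭(1)`, so this sum is the same for all frames. -/
def E (Q : SpGLStructure n M) (k : ℕ) (r : ℤ) (x : M) : Submodule ℂ (Covector n k x) :=
  ⨅ u ∈ Q.frames x, isotypic k r u

/-- `E_{k,r}` and the sum of the other `E_{k,s}` are complementary in the `k`-covectors at `x`. -/
def Splits (Q : SpGLStructure n M) (k : ℕ) (r : ℤ) (x : M) : Prop :=
  IsCompl (Q.E k r x) (⨆ s : {s : ℤ // s ≠ r}, Q.E k s x)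

open Classical in
/-- The projection `π_{k,r}` of the `k`-covectors at `x` onto `E_{k,r}`, along the sum of the other
`E_{k,s}`. -/
def proj (Q : SpGLStructure n M) (k : ℕ) (r : ℤ) (x : M) :
    Covector n k x →ₗ[ℂ] Covector n k x :=
  if h : Q.Splits k r x then Submodule.projection _ _ h else 0

/-- `α` is a smooth section of `E_{k,r}`. -/
def IsSmoothSection (Q : SpGLStructure n M) (k : ℕ) (r : ℤ) (α : ∀ x : M, Covector n k x) : Prop :=
  IsSmoothForm α ∧ ∀ x, α x ∈ Q.E k r x

/-- The operator `𝒟 = π_{k+1,r+1} ∘ d`, to be applied to sections of `E_{k,r}`. -/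
def D (Q : SpGLStructure n M) {k : ℕ} (r : ℤ) (α : ∀ x : M, Covector n k x) (x : M) :
    Covector n (k + 1) x :=
  Q.proj (k + 1) (r + 1) x (extD α x)

/-- The operator `𝒟̄ = π_{k+1,r-1} ∘ d`, to be applied to sections of `E_{k,r}`. -/
def Dbar (Q : SpGLStructure n M) {k : ℕ} (r : ℤ) (α : ∀ x : M, Covector n k x) (x : M) :
    Covector n (k + 1) x :=
  Q.proj (k + 1) (r - 1) x (extD α x)

end SpGLStructure

end QuaternionicForms

end

/-!
For `r ≥ -1` the isotypic part `E_{k,r}` is the eigenspace of the Casimir operator `𝒞` for the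
eigenvalue `c_r = -r (r + 2)`. A torsion-free connection `∇` preserving `Q` preserves this
eigenspace, and `dα` is the alternation of `∇α`, which lies in `T*M ⊗ E_{k,r}`. Since `T*M ⊗ ℂ` is
a sum of copies of `V_1`, the Clebsch–Gordan rule leaves only the weights `r ± 1` in this product,
and hence in its equivariant image: `(𝒞 - c_{r+1}) (𝒞 - c_{r-1}) dα = 0`. The two formulas are
Lagrange interpolation in `𝒞`, with denominator `c_{r+1} - c_{r-1} = -4 (r + 1)`.
-/

noncomputable section

namespace QuaternionicForms

/-! ### Triples satisfying the relations of `𝔰𝔭(1)` -/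

section Su2

variable {A : Type*} [Ring A] {I J K : A}

/-- The commutation relations of `𝔰𝔭(1) ≅ 𝔰𝔲(2)`, normalised as for the imaginary quaternion units
`i`, `j`, `k`. -/
structure IsSu2Triple (I J K : A) : Prop where
  comm_IJ : I * J - J * I = 2 * K
  comm_JK : J * K - K * J = 2 * I
  comm_KI : K * I - I * K = 2 * J

/-- The Casimir element of an `IsSu2Triple`. -/
def su2Casimir (I J K : A) : A := I * I + J * J + K * K

theorem su2Casimir_rotate (I J K : A) : su2Casimir J K I = su2Casimir I J K := by
  unfold su2Casimir
  abel

theorem su2Casimir_commute_of_commute {x : A} (hI : Commute I x) (hJ : Commute J x)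
    (hK : Commute K x) : Commute (su2Casimir I J K) x :=
  ((hI.mul_left hI).add_left (hJ.mul_left hJ)).add_left (hK.mul_left hK)

namespace IsSu2Triple

theorem rotate (h : IsSu2Triple I J K) : IsSu2Triple J K I := ⟨h.comm_JK, h.comm_KI, h.comm_IJ⟩

theorem commute_su2Casimir (h : IsSu2Triple I J K) : Commute (su2Casimir I J K) I := by
  unfold su2Casimir Commute SemiconjBy
  linear_combination (norm := noncomm_ring)
    -(J * h.comm_IJ) - h.comm_IJ * J + K * h.comm_KI + h.comm_KI * K

end IsSu2Triple

section TensorQuaternions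

variable {S : QuaternionAlgebra.Basis A (-1 : ℤ) 0 (-1)}

theorem su2Casimir_add_basis (hI : Commute I S.i) (hJ : Commute J S.j) (hK : Commute K S.k) :
    su2Casimir (I + S.i) (J + S.j) (K + S.k) =
      su2Casimir I J K + 2 * (I * S.i + J * S.j + K * S.k) - 3 := by
  have sq {x s : A} (hx : Commute x s) (hs : s * s = -1) :
      (x + s) * (x + s) = x * x + 2 * (x * s) - 1 := by
    linear_combination (norm := noncomm_ring) hs - hx.eq
  rw [su2Casimir, sq hI (by simp), sq hJ (by simp), sq hK (by simp), su2Casimir]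
  grind

theorem IsSu2Triple.sum_mul_basis_mul_self (h : IsSu2Triple I J K)
    (hS : ∀ x ∈ ({I, J, K} : Set A), ∀ s ∈ ({S.i, S.j, S.k} : Set A), Commute s x) :
    (I * S.i + J * S.j + K * S.k) * (I * S.i + J * S.j + K * S.k) =
      2 * (I * S.i + J * S.j + K * S.k) - su2Casimir I J K := by
  simp only [Set.mem_insert_iff, Set.mem_singleton_iff, forall_eq_or_imp, forall_eq] at hS
  obtain ⟨⟨hIi, hIj, hIk⟩, ⟨hJi, hJj, hJk⟩, hKi, hKj, hKk⟩ := hS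
  have comm_k := congrArg (· * S.k) h.comm_IJ
  have comm_i := congrArg (· * S.i) h.comm_JK
  have comm_j := congrArg (· * S.j) h.comm_KI
  simp only [sub_mul, mul_assoc] at comm_i comm_j comm_k
  simp only [add_mul, mul_add, hIi.mul_mul_mul_comm, hIj.mul_mul_mul_comm, hIk.mul_mul_mul_comm,
    hJi.mul_mul_mul_comm, hJj.mul_mul_mul_comm, hJk.mul_mul_mul_comm, hKi.mul_mul_mul_comm,
    hKj.mul_mul_mul_comm, hKk.mul_mul_mul_comm, S.i_mul_i, S.j_mul_j, S.k_mul_k, S.i_mul_j,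
    S.j_mul_i, S.i_mul_k, S.k_mul_i, S.k_mul_j, S.j_mul_k, su2Casimir]
  simp only [Int.reduceNeg, neg_smul, one_smul, mul_neg, mul_one, zero_smul, mul_zero, add_zero,
    zero_sub, mul_assoc, neg_neg, neg_zero, sub_neg_eq_add, zero_add]
  grind

/-- The Clebsch–Gordan rule for `V_r ⊗ ℍ ≅ 2 V_{r+1} ⊕ 2 V_{r-1}`, as a quadratic relation between
the Casimir elements of the tensor product and of `V_r`. -/
theorem IsSu2Triple.su2Casimir_add_basis_mul_self (h : IsSu2Triple I J K)
    (hS : ∀ x ∈ ({I, J, K} : Set A), ∀ s ∈ ({S.i, S.j, S.k} : Set A), Commute s x) :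
    let C := su2Casimir I J K
    let D := su2Casimir (I + S.i) (J + S.j) (K + S.k)
    D * D = 2 * (D * C) - 2 * D - C * C - 2 * C + 3 := by
  intro C D
  set T := I * S.i + J * S.j + K * S.k
  have hD : D = C + 2 * T - 3 := su2Casimir_add_basis (hS I (by simp) _ (by simp)).symm
    (hS J (by simp) _ (by simp)).symm (hS K (by simp) _ (by simp)).symm
  have T_sq : T * T = 2 * T - C := h.sum_mul_basis_mul_self hS
  have commute_basis {s : A} (hs : s ∈ ({S.i, S.j, S.k} : Set A)) : Commute C s :=
    su2Casimir_commute_of_commute ((hS I (by simp) s hs).symm) ((hS J (by simp) s hs).symm)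
      ((hS K (by simp) s hs).symm)
  have CT : C * T = T * C :=
    ((h.commute_su2Casimir.mul_right (commute_basis (by simp))).add_right
      ((su2Casimir_rotate I J K ▸ h.rotate.commute_su2Casimir).mul_right
        (commute_basis (by simp)))).add_right
      ((su2Casimir_rotate K I J ▸ h.rotate.rotate.commute_su2Casimir).mul_right
        (commute_basis (by simp)))
  rw [hD]
  linear_combination (norm := noncomm_ring) 4 * T_sq + 2 * CT

end TensorQuaternions
end Su2

section HighestWeight

/-- The value `-r (r + 2)` of the Casimir operator on the irreducible representation `V_r`. -/
def casimirValue (r : ℤ) : ℂ := -(r * (r + 2))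

theorem casimirValue_injOn : Set.InjOn casimirValue (Set.Ici (-1)) := by
  intro r hr s hs h
  have h : (r - s) * (r + s + 2) = 0 := by
    unfold casimirValue at h
    have : ((r - s) * (r + s + 2) : ℂ) = 0 := by linear_combination -h
    exact_mod_cast this
  rw [Set.mem_Ici] at hr hs
  rcases mul_eq_zero.1 h with h | h <;> lia

section Algebra

variable {A : Type*} [Ring A] [Algebra ℂ A] {I J K : A}

namespace IsSu2Triple

theorem mul_raise (h : IsSu2Triple I J K) :
    I * (J - Complex.I • K) = (J - Complex.I • K) * (I + (2 * Complex.I) • 1) := by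
  have comm_IJ := h.comm_IJ
  have comm_KI := h.comm_KI
  simp only [two_mul, mul_add, sub_mul, mul_sub, mul_smul_comm, smul_mul_assoc, mul_one] at *
  linear_combination (norm := match_scalars <;> grind [Complex.I_sq]) comm_IJ + Complex.I • comm_KI

theorem mul_lower (h : IsSu2Triple I J K) :
    I * (J + Complex.I • K) = (J + Complex.I • K) * (I - (2 * Complex.I) • 1) := by
  have comm_IJ := h.comm_IJ
  have comm_KI := h.comm_KI
  simp only [two_mul, mul_add, add_mul, mul_sub, mul_smul_comm, smul_mul_assoc, mul_one] at *
  linear_combination (norm := match_scalars <;> grind [Complex.I_sq]) comm_IJ - Complex.I • comm_KI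

theorem raise_mul_lower (h : IsSu2Triple I J K) :
    (J - Complex.I • K) * (J + Complex.I • K) =
      J * J + K * K + (2 * Complex.I) • I := by
  have comm_JK := h.comm_JK
  simp only [two_mul, mul_add, sub_mul, mul_smul_comm, smul_mul_assoc] at *
  linear_combination (norm := match_scalars <;> grind [Complex.I_sq]) Complex.I • comm_JK

theorem lower_mul_raise (h : IsSu2Triple I J K) :
    (J + Complex.I • K) * (J - Complex.I • K) =
      J * J + K * K - (2 * Complex.I) • I := by
  have comm_JK := h.comm_JK
  simp only [two_mul, mul_sub, add_mul, mul_smul_comm, smul_mul_assoc] at *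
  linear_combination (norm := match_scalars <;> grind [Complex.I_sq]) -Complex.I • comm_JK

attribute [local instance] LieRing.ofAssociativeRing in
theorem isSl2Triple (h : IsSu2Triple I J K) (hI : I ≠ 0) :
    IsSl2Triple (-Complex.I • I) (J - Complex.I • K) ((-1 / 4 : ℂ) • (J + Complex.I • K)) where
  h_ne_zero := by simpa using hI
  lie_e_f := by
    rw [LieRing.of_associative_ring_bracket, mul_smul_comm, smul_mul_assoc, h.raise_mul_lower,
      h.lower_mul_raise]
    module
  lie_h_e_nsmul := by
    rw [LieRing.of_associative_ring_bracket, smul_mul_assoc, mul_smul_comm, h.mul_raise, mul_add,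
      mul_smul_comm, mul_one]
    match_scalars <;> grind [Complex.I_sq]
  lie_h_f_nsmul := by
    rw [LieRing.of_associative_ring_bracket]
    simp only [smul_mul_assoc, mul_smul_comm, h.mul_lower, mul_sub, mul_one]
    match_scalars <;> grind [Complex.I_sq]

end IsSu2Triple

end Algebra

variable {X : Type*} [AddCommGroup X] [Module ℂ X] {I J K : Module.End ℂ X} {w : X} {μ : ℂ}

namespace IsSu2Triple

theorem raise_mem_eigenspace (h : IsSu2Triple I J K) (hw : w ∈ I.eigenspace μ) :
    (J - Complex.I • K) w ∈ I.eigenspace (μ + 2 * Complex.I) := by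
  rw [Module.End.mem_eigenspace_iff] at hw ⊢
  rw [← Module.End.mul_apply, h.mul_raise, Module.End.mul_apply, LinearMap.add_apply, hw,
    LinearMap.smul_apply, Module.End.one_apply, ← add_smul, map_smul]

theorem su2Casimir_apply_of_raise_eq_zero (h : IsSu2Triple I J K) (hw : w ∈ I.eigenspace μ)
    (hraise : (J - Complex.I • K) w = 0) :
    su2Casimir I J K w = (μ * (μ + 2 * Complex.I)) • w := by
  rw [Module.End.mem_eigenspace_iff] at hw
  have := congrArg (· w) h.lower_mul_raise
  simp only [Module.End.mul_apply, hraise, map_zero, LinearMap.sub_apply, LinearMap.add_apply,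
    LinearMap.smul_apply, hw] at this
  simp only [su2Casimir, LinearMap.add_apply, Module.End.mul_apply, hw, map_smul]
  linear_combination (norm := module) -this

attribute [local instance] LieRing.ofAssociativeRing LieRingModule.ofAssociativeModule in
theorem exists_nat_eq_of_raise_eq_zero [FiniteDimensional ℂ X] (h : IsSu2Triple I J K)
    (hw : I.HasEigenvector μ w) (hraise : (J - Complex.I • K) w = 0) :
    ∃ m : ℕ, μ = m * Complex.I := by
  by_cases hI : I = 0
  · exact ⟨0, by simpa [hI, hw.2, eq_comm] using hw.apply_eq_smul⟩
  have primitive : (h.isSl2Triple hI).HasPrimitiveVectorWith w (-Complex.I * μ) :=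
    ⟨hw.2, by simp [hw.apply_eq_smul, smul_smul], hraise⟩
  obtain ⟨m, hm⟩ := primitive.exists_nat
  exact ⟨m, by rw [← hm]; grind [Complex.I_sq]⟩

/-- An eigenvalue of largest imaginary part is a highest weight, since raising adds `2 √-1`. -/
theorem exists_isGreatest_weight [FiniteDimensional ℂ X] [Nontrivial X] (h : IsSu2Triple I J K) :
    ∃ m : ℕ, IsGreatest {s : ℤ | I.HasEigenvalue (s * Complex.I)} m ∧
      (su2Casimir I J K).HasEigenvalue (casimirValue m) := by
  obtain ⟨μ, hμ, im_le⟩ := Set.exists_max_image {μ | I.HasEigenvalue μ} Complex.im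
    (Module.End.finite_hasEigenvalue I) (Module.End.exists_eigenvalue I)
  obtain ⟨w, hw⟩ := Module.End.HasEigenvalue.exists_hasEigenvector hμ
  have raise_eq_zero : (J - Complex.I • K) w = 0 := by
    by_contra hne
    have := im_le _ (Module.End.hasEigenvalue_of_hasEigenvector
      ⟨h.raise_mem_eigenspace hw.1, hne⟩)
    norm_num at this
  obtain ⟨m, rfl⟩ := h.exists_nat_eq_of_raise_eq_zero hw raise_eq_zero
  refine ⟨m, ⟨by simpa using hμ, fun s hs => ?_⟩, ?_⟩
  · have : (s : ℝ) ≤ m := by simpa using im_le _ hs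
    exact_mod_cast this
  · refine Module.End.hasEigenvalue_of_hasEigenvector (x := w)
      ⟨Module.End.mem_eigenspace_iff.2 ?_, hw.2⟩
    rw [h.su2Casimir_apply_of_raise_eq_zero hw.1 raise_eq_zero, casimirValue]
    congr 1
    push_cast
    grind [Complex.I_sq]

end IsSu2Triple

end HighestWeight

/-! ### The action of `𝔰𝔭(1)` on forms -/

section FormAction

variable {V V' : Type*} [AddCommGroup V] [Module ℝ V] [TopologicalSpace V]
  [AddCommGroup V'] [Module ℝ V'] [TopologicalSpace V'] {k : ℕ}

theorem formAction_add [ContinuousAdd V] (A B : V →L[ℝ] V) :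
    formAction (k := k) (A + B) = formAction A + formAction B := by
  ext β v
  simp [formAction_apply, ContinuousAlternatingMap.map_update_add, Finset.sum_add_distrib, add_comm]

theorem formAction_smul [ContinuousConstSMul ℝ V] (c : ℝ) (A : V →L[ℝ] V) :
    formAction (k := k) (c • A) = (c : ℂ) • formAction A := by
  ext β v
  simp [formAction_apply, ContinuousAlternatingMap.map_update_smul, Finset.mul_sum]

theorem formAction_formAction_apply (A B : V →L[ℝ] V) (β : V [⋀^Fin k]→L[ℝ] ℂ) (v : Fin k → V) :
    formAction A (formAction B β) v =
      ∑ j, β (Function.update v j (B (A (v j)))) +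
        ∑ j, ∑ l ∈ Finset.univ.erase j,
          β (Function.update (Function.update v j (A (v j))) l (B (v l))) := by
  simp only [formAction_apply, Finset.sum_neg_distrib, neg_neg, ← Finset.sum_add_distrib]
  refine Finset.sum_congr rfl fun j _ => ?_
  rw [← Finset.add_sum_erase _ _ (Finset.mem_univ j), Function.update_self, Function.update_idem]
  congr 1
  refine Finset.sum_congr rfl fun l hl => ?_
  rw [Function.update_of_ne (Finset.ne_of_mem_erase hl)]

theorem formAction_comm [IsTopologicalAddGroup V] (A B : V →L[ℝ] V) :
    formAction (k := k) A * formAction B - formAction B * formAction A =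
      formAction (A * B - B * A) := by
  ext β v
  have cross : (∑ j, ∑ l ∈ Finset.univ.erase j,
        β (Function.update (Function.update v j (A (v j))) l (B (v l)))) =
      ∑ j, ∑ l ∈ Finset.univ.erase j,
        β (Function.update (Function.update v j (B (v j))) l (A (v l))) := by
    rw [Finset.sum_comm' (t' := Finset.univ) (s' := fun l => Finset.univ.erase l)
      (by simp [eq_comm])]
    refine Finset.sum_congr rfl fun j _ => Finset.sum_congr rfl fun l hl => ?_
    rw [Function.update_comm (Finset.ne_of_mem_erase hl)]
  rw [LinearMap.sub_apply, ContinuousAlternatingMap.sub_apply, Module.End.mul_apply,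
    Module.End.mul_apply, formAction_formAction_apply, formAction_formAction_apply, cross,
    add_sub_add_right_eq_sub, formAction_apply, ← Finset.sum_sub_distrib,
    ← Finset.sum_neg_distrib]
  refine Finset.sum_congr rfl fun j _ => ?_
  rw [sub_apply, ContinuousAlternatingMap.map_update_sub, neg_sub]
  rfl

theorem formAction_compContinuousLinearMap {L : V' →L[ℝ] V} {A : V →L[ℝ] V} {A' : V' →L[ℝ] V'}
    (h : ∀ v, L (A' v) = A (L v)) (β : V [⋀^Fin k]→L[ℝ] ℂ) :
    formAction A' (β.compContinuousLinearMap L) =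
      (formAction A β).compContinuousLinearMap L := by
  ext v
  simp only [formAction_apply, ContinuousAlternatingMap.compContinuousLinearMap_apply,
    Function.comp_update, h, Function.comp_apply]

end FormAction

section QuatEnd

variable {V V' : Type*} [AddCommGroup V] [Module ℝ V] [TopologicalSpace V]
  [AddCommGroup V'] [Module ℝ V'] [TopologicalSpace V'] {n k : ℕ} (u : HSpace n ≃L[ℝ] V)

theorem quatEnd_apply (p : ℍ[ℝ]) (v : V) : quatEnd u p v = u (p • u.symm v) := rfl

theorem quatEnd_mul (p q : ℍ[ℝ]) : quatEnd u (p * q) = quatEnd u p * quatEnd u q := by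
  ext v
  simp [quatEnd_apply, mul_smul]

theorem quatEnd_add [ContinuousAdd V] (p q : ℍ[ℝ]) :
    quatEnd u (p + q) = quatEnd u p + quatEnd u q := by
  ext v
  simp [quatEnd_apply, add_smul]

theorem quatEnd_sub [IsTopologicalAddGroup V] (p q : ℍ[ℝ]) :
    quatEnd u (p - q) = quatEnd u p - quatEnd u q := by
  ext v
  simp [quatEnd_apply, sub_smul]

theorem quatEnd_smul [ContinuousConstSMul ℝ V] (c : ℝ) (p : ℍ[ℝ]) :
    quatEnd u (c • p) = c • quatEnd u p := by
  ext v
  simp [quatEnd_apply, smul_assoc]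

variable {u} in
theorem quatEnd_intertwines {u' : HSpace n ≃L[ℝ] V'} {L : V' →L[ℝ] V} (h : ∀ v, L (u' v) = u v)
    (p : ℍ[ℝ]) (v : V') : L (quatEnd u' p v) = quatEnd u p (L v) := by
  obtain ⟨v, rfl⟩ := u'.surjective v
  simp [quatEnd_apply, h]

end QuatEnd

theorem eq_imI_smul_add_imJ_smul_add_imK_smul {p : ℍ[ℝ]} (hp : p.re = 0) :
    p = p.imI • qi + p.imJ • qj + p.imK • qk := by
  ext <;> simp [hp] <;> simp [qi, qj, qk]

section Sp1Action

variable {V V' : Type*} [AddCommGroup V] [Module ℝ V] [TopologicalSpace V]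
  [AddCommGroup V'] [Module ℝ V'] [TopologicalSpace V'] {n k : ℕ} (u : HSpace n ≃L[ℝ] V)

theorem casimir_eq_su2Casimir :
    casimir (k := k) u = su2Casimir (sp1Action u qi) (sp1Action u qj) (sp1Action u qk) := rfl

variable {u} in
theorem sp1Action_compContinuousLinearMap {u' : HSpace n ≃L[ℝ] V'} {L : V' →L[ℝ] V}
    (h : ∀ v, L (u' v) = u v) (p : ℍ[ℝ]) (β : V [⋀^Fin k]→L[ℝ] ℂ) :
    sp1Action u' p (β.compContinuousLinearMap L) =
      (sp1Action u p β).compContinuousLinearMap L :=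
  formAction_compContinuousLinearMap (quatEnd_intertwines h p) β

variable {u} in
theorem compContinuousLinearMap_mem_eigenspace_casimir {u' : HSpace n ≃L[ℝ] V'} {L : V' →L[ℝ] V}
    (h : ∀ v, L (u' v) = u v) {c : ℂ} {β : V [⋀^Fin k]→L[ℝ] ℂ}
    (hβ : β ∈ Module.End.eigenspace (casimir u) c) :
    β.compContinuousLinearMap L ∈ Module.End.eigenspace (casimir u') c := by
  rw [Module.End.mem_eigenspace_iff] at hβ ⊢
  have : casimir u' (β.compContinuousLinearMap L) = (casimir u β).compContinuousLinearMap L := by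
    simp only [casimir, LinearMap.add_apply, LinearMap.comp_apply,
      sp1Action_compContinuousLinearMap h]
    rfl
  rw [this, hβ]
  rfl

theorem sp1Action_comm [IsTopologicalAddGroup V] (p q : ℍ[ℝ]) :
    sp1Action (k := k) u p * sp1Action u q - sp1Action u q * sp1Action u p =
      sp1Action u (p * q - q * p) := by
  simp only [sp1Action, formAction_comm, quatEnd_sub, quatEnd_mul]

theorem sp1Action_smul [ContinuousConstSMul ℝ V] (c : ℝ) (p : ℍ[ℝ]) :
    sp1Action (k := k) u (c • p) = (c : ℂ) • sp1Action u p := by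
  simp only [sp1Action, quatEnd_smul, formAction_smul]

variable [IsTopologicalAddGroup V] [ContinuousConstSMul ℝ V]

theorem sp1Action_of_re_eq_zero {p : ℍ[ℝ]} (hp : p.re = 0) :
    sp1Action (k := k) u p = (p.imI : ℂ) • sp1Action u qi + (p.imJ : ℂ) • sp1Action u qj
      + (p.imK : ℂ) • sp1Action u qk := by
  conv_lhs => rw [eq_imI_smul_add_imJ_smul_add_imK_smul hp]
  simp only [sp1Action, quatEnd_add, quatEnd_smul, formAction_add, formAction_smul]

theorem isSu2Triple_sp1Action :
    IsSu2Triple (sp1Action (k := k) u qi) (sp1Action u qj) (sp1Action u qk) := by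
  have comm {p q r : ℍ[ℝ]} (h : p * q - q * p = (2 : ℝ) • r) :
      sp1Action (k := k) u p * sp1Action u q - sp1Action u q * sp1Action u p =
        2 * sp1Action u r := by
    rw [sp1Action_comm, h, sp1Action_smul, Complex.ofReal_ofNat, ofNat_smul_eq_nsmul,
      nsmul_eq_mul, Nat.cast_ofNat]
  constructor <;> apply comm <;> ext <;> simp <;> norm_num [qi, qj, qk]

theorem commute_casimir_sp1Action {p : ℍ[ℝ]} (hp : p.re = 0) :
    Commute (casimir (k := k) u) (sp1Action u p) := by
  have h := isSu2Triple_sp1Action (k := k) u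
  rw [sp1Action_of_re_eq_zero u hp, casimir_eq_su2Casimir]
  refine ((h.commute_su2Casimir.smul_right _).add_right (.smul_right ?_ _)).add_right
    (.smul_right ?_ _)
  · simpa only [su2Casimir_rotate] using h.rotate.commute_su2Casimir
  · simpa only [su2Casimir_rotate] using h.rotate.rotate.commute_su2Casimir

end Sp1Action

section CompleteReducibility

theorem le_sSup_minimal_of_exists_isCompl {α : Type*} [CompleteLattice α] [IsModularLattice α]
    [WellFoundedLT α] {P : α → Prop} (inf : ∀ ⦃a b⦄, P a → P b → P (a ⊓ b))
    (exists_isCompl : ∀ a, P a → ∃ b, P b ∧ IsCompl a b) {a : α} (ha : P a) :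
    a ≤ sSup {s | s ≤ a ∧ Minimal (fun s => P s ∧ s ≠ ⊥) s} := by
  induction a using WellFoundedLT.induction with
  | ind a ih =>
  by_cases h0 : a = ⊥
  · simp [h0]
  obtain ⟨s, hsa, hs⟩ := exists_minimal_le_of_wellFoundedLT (fun s => P s ∧ s ≠ ⊥) a ⟨ha, h0⟩
  obtain ⟨t, ht, hst⟩ := exists_isCompl s hs.prop.1
  have sup_eq : s ⊔ t ⊓ a = a := by
    rw [← sup_inf_assoc_of_le t hsa, hst.sup_eq_top, top_inf_eq]
  have lt : t ⊓ a < a := by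
    refine inf_le_right.lt_of_ne fun h => hs.prop.2 ?_
    exact hst.disjoint.eq_bot_of_le (hsa.trans (inf_eq_right.1 h))
  refine sup_eq.symm.trans_le (sup_le (le_sSup ⟨hsa, hs⟩) ((ih _ lt (inf ht ha)).trans ?_))
  exact sSup_le_sSup fun _ h => ⟨h.1.trans inf_le_right, h.2⟩

end CompleteReducibility

section InvariantInner

theorem isCompl_comap_orthogonal_map {𝕜 X F : Type*} [RCLike 𝕜] [AddCommGroup X] [Module 𝕜 X]
    [NormedAddCommGroup F] [InnerProductSpace 𝕜 F] {Φ : X →ₗ[𝕜] F} (hΦ : Function.Injective Φ)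
    (S : Submodule 𝕜 X) [(S.map Φ).HasOrthogonalProjection] :
    IsCompl S ((S.map Φ)ᗮ.comap Φ) where
  disjoint := by
    rw [Submodule.disjoint_def]
    intro x hx hx'
    refine hΦ ((inner_self_eq_zero (𝕜 := 𝕜)).1 ?_ |>.trans (map_zero Φ).symm)
    exact hx' _ (Submodule.mem_map_of_mem hx)
  codisjoint := by
    rw [codisjoint_iff_le_sup]
    intro x _
    obtain ⟨_, ⟨s, hs, rfl⟩, z, hz, hsz⟩ := (S.map Φ).exists_add_mem_mem_orthogonal (Φ x)
    refine Submodule.mem_sup.2 ⟨s, hs, x - s, ?_, add_sub_cancel s x⟩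
    rwa [Submodule.mem_comap, map_sub, hsz, add_sub_cancel_left]

variable {V : Type*} [AddCommGroup V] [Module ℝ V] [TopologicalSpace V] {n k : ℕ} {ι : Type*}

/-- The values of a form on the tuples of members of a family of vectors. Pulling back the inner
product along this map, for a basis of `V`, makes the forms an inner product space. -/
def formValues (b : ι → V) : (V [⋀^Fin k]→L[ℝ] ℂ) →ₗ[ℂ] EuclideanSpace ℂ (Fin k → ι) where
  toFun β := WithLp.toLp 2 fun f => β (b ∘ f)
  map_add' β γ := by ext f; simp
  map_smul' c β := by ext f; simp

theorem formValues_apply (b : ι → V) (β : V [⋀^Fin k]→L[ℝ] ℂ) (f : Fin k → ι) :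
    formValues b β f = β (b ∘ f) := rfl

theorem formValues_injective (b : Module.Basis ι ℝ V) :
    Function.Injective (formValues (k := k) b) := by
  intro β γ h
  apply ContinuousAlternatingMap.toAlternatingMap_injective
  apply AlternatingMap.coe_multilinearMap_injective
  refine Module.Basis.ext_multilinear (fun _ => b) fun f => ?_
  exact congrArg (fun x : EuclideanSpace ℂ (Fin k → ι) => x f) h

variable [Fintype ι]

theorem formValues_formAction_apply (b : Module.Basis ι ℝ V) (A : V →L[ℝ] V)
    (β : V [⋀^Fin k]→L[ℝ] ℂ) (f : Fin k → ι) :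
    formValues b (formAction A β) f = -∑ j, ∑ d, (b.repr (A (b (f j))) d : ℂ) *
      formValues b β (Function.update f j d) := by
  rw [formValues_apply, formAction_apply]
  congr 1
  refine Finset.sum_congr rfl fun j _ => ?_
  conv_lhs => rw [Function.comp_apply, ← b.sum_repr (A (b (f j)))]
  simp only [← β.coe_toAlternatingMap, AlternatingMap.map_update_sum,
    AlternatingMap.map_update_smul, Complex.real_smul, formValues_apply, Function.comp_update]

theorem inner_formValues_formAction (b : Module.Basis ι ℝ V) {A : V →L[ℝ] V}
    (hA : ∀ c d, b.repr (A (b c)) d = -b.repr (A (b d)) c) (β γ : V [⋀^Fin k]→L[ℝ] ℂ) :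
    inner ℂ (formValues b (formAction A β)) (formValues b γ) =
      -inner ℂ (formValues b β) (formValues b (formAction A γ)) := by
  classical
  simp only [PiLp.inner_apply, RCLike.inner_apply, formValues_formAction_apply, map_neg, map_sum,
    map_mul, neg_mul, mul_neg, Finset.sum_neg_distrib, Finset.mul_sum, Finset.sum_mul,
    Complex.conj_ofReal, neg_neg]
  rw [Finset.sum_comm, Finset.sum_comm (f := fun f j => ∑ d, _ * _ * _), ← Finset.sum_neg_distrib]
  refine Finset.sum_congr rfl fun j _ => ?_
  rw [← Fintype.sum_prod_type', ← Fintype.sum_prod_type', ← Finset.sum_neg_distrib]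
  have involutive : Function.Involutive fun x : (Fin k → ι) × ι =>
      (Function.update x.1 j x.2, x.1 j) := fun x => by simp
  refine Fintype.sum_equiv involutive.toPerm _ _ fun x => ?_
  simp only [Function.Involutive.coe_toPerm, Function.update_self, Function.update_idem,
    Function.update_eq_self, hA (x.1 j) x.2]
  push_cast
  ring

theorem inner_mul_left_of_re_eq_zero {p : ℍ[ℝ]} (hp : p.re = 0) (a b : ℍ[ℝ]) :
    inner ℝ (p * a) b = -inner ℝ a (p * b) := by
  simp [Quaternion.inner_def, hp]
  ring

/-- The real basis of `V` obtained by applying a frame to an orthonormal basis of `ℍⁿ`. -/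
def frameBasis (u : HSpace n ≃L[ℝ] V) :
    Module.Basis ((_ : Fin n) × Fin (Module.finrank ℝ ℍ[ℝ])) ℝ V :=
  (Pi.basis fun _ : Fin n => (stdOrthonormalBasis ℝ ℍ[ℝ]).toBasis).map u.toLinearEquiv

theorem frameBasis_repr_quatEnd (u : HSpace n ≃L[ℝ] V) {p : ℍ[ℝ]} (hp : p.re = 0)
    (c d : (_ : Fin n) × Fin (Module.finrank ℝ ℍ[ℝ])) :
    (frameBasis u).repr (quatEnd u p (frameBasis u c)) d =
      -(frameBasis u).repr (quatEnd u p (frameBasis u d)) c := by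
  obtain ⟨i, a⟩ := c
  obtain ⟨j, b⟩ := d
  obtain rfl | hij := eq_or_ne i j
  · have skew := inner_mul_left_of_re_eq_zero hp (stdOrthonormalBasis ℝ ℍ[ℝ] a)
      (stdOrthonormalBasis ℝ ℍ[ℝ] b)
    rw [real_inner_comm] at skew
    simpa [frameBasis, quatEnd_apply, OrthonormalBasis.repr_apply_apply] using skew
  · simp [frameBasis, quatEnd_apply, hij, hij.symm]

theorem finiteDimensional_forms (u : HSpace n ≃L[ℝ] V) :
    FiniteDimensional ℂ (V [⋀^Fin k]→L[ℝ] ℂ) :=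
  .of_injective _ (formValues_injective (frameBasis u))

end InvariantInner

section Subrep

variable {V : Type*} [AddCommGroup V] [Module ℝ V] [TopologicalSpace V] {n k : ℕ}
  {u : HSpace n ≃L[ℝ] V} {W W' : Submodule ℂ (V [⋀^Fin k]→L[ℝ] ℂ)}

theorem IsSubrep.inf (h : IsSubrep u W) (h' : IsSubrep u W') : IsSubrep u (W ⊓ W') :=
  fun p hp w hw => ⟨h p hp w hw.1, h' p hp w hw.2⟩

theorem IsSubrep.exists_isCompl (h : IsSubrep u W) : ∃ W', IsSubrep u W' ∧ IsCompl W W' := by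
  refine ⟨_, ?_, isCompl_comap_orthogonal_map (formValues_injective (frameBasis u)) W⟩
  rintro p hp w hw _ ⟨x, hx, rfl⟩
  rw [← neg_eq_zero, sp1Action, ← inner_formValues_formAction _ (frameBasis_repr_quatEnd u hp)]
  exact hw _ (Submodule.mem_map_of_mem (h p hp x hx))

theorem isIrredSubrep_iff_minimal :
    IsIrredSubrep u W ↔ Minimal (fun W => IsSubrep u W ∧ W ≠ ⊥) W := by
  refine ⟨fun ⟨h, h0, hW⟩ => ⟨⟨h, h0⟩, fun W' h' le => ((hW W' le h'.1).resolve_left h'.2).ge⟩,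
    fun h => ⟨h.prop.1, h.prop.2, fun W' le h' => or_iff_not_imp_left.2 fun h0 => ?_⟩⟩
  exact le.antisymm (h.le_of_le ⟨h', h0⟩ le)

theorem IsSubrep.le_sSup_irred (h : IsSubrep u W) :
    W ≤ sSup {S | S ≤ W ∧ IsIrredSubrep u S} := by
  have := finiteDimensional_forms (k := k) u
  simpa only [isIrredSubrep_iff_minimal] using
    le_sSup_minimal_of_exists_isCompl (fun _ _ => IsSubrep.inf) (fun _ => IsSubrep.exists_isCompl) h

end Subrep

section FrameIndependence

variable {V : Type*} [AddCommGroup V] [Module ℝ V] [TopologicalSpace V] {n k : ℕ}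
  (u : HSpace n ≃L[ℝ] V)

theorem quatEnd_trans {g : HSpace n ≃L[ℝ] HSpace n} {q : ℍ[ℝ]} (hq : ‖q‖ = 1)
    {A : HSpace n ≃ₗ[ℍ[ℝ]] HSpace n} (hg : ∀ v, g v = q • A v) (p : ℍ[ℝ]) :
    quatEnd (g.trans u) p = quatEnd u (q * p * star q) := by
  have star_mul : star q * q = 1 := by
    rw [Quaternion.star_mul_self, Quaternion.normSq_eq_norm_mul_self, hq]
    simp
  ext v
  obtain ⟨w, rfl⟩ := (g.trans u).surjective v
  rw [quatEnd_apply, ContinuousLinearEquiv.symm_apply_apply]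
  simp [quatEnd_apply, hg, smul_smul, mul_assoc, star_mul]

theorem casimir_trans [IsTopologicalAddGroup V] [ContinuousConstSMul ℝ V]
    {g : HSpace n ≃L[ℝ] HSpace n} (hg : IsSpGL g) :
    casimir (k := k) (g.trans u) = casimir u := by
  obtain ⟨q, hq, A, hA⟩ := hg
  have normSq : ((q.re : ℂ) ^ 2 + (q.imI : ℂ) ^ 2 + (q.imJ : ℂ) ^ 2 + (q.imK : ℂ) ^ 2) ^ 2 = 1 := by
    have : Quaternion.normSq q ^ 2 = 1 := by simp [Quaternion.normSq_eq_norm_mul_self, hq]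
    rw [Quaternion.normSq_def'] at this
    exact_mod_cast this
  have sp1Action_trans {p : ℍ[ℝ]} (hp : p.re = 0) :
      sp1Action (k := k) (g.trans u) p = ((q * p * star q).imI : ℂ) • sp1Action u qi +
        ((q * p * star q).imJ : ℂ) • sp1Action u qj +
        ((q * p * star q).imK : ℂ) • sp1Action u qk := by
    rw [sp1Action, quatEnd_trans u hq hA, ← sp1Action,
      sp1Action_of_re_eq_zero u (by simp [hp]; ring)]
  rw [casimir_eq_su2Casimir, casimir_eq_su2Casimir, sp1Action_trans rfl, sp1Action_trans rfl,
    sp1Action_trans rfl]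
  simp only [su2Casimir, add_mul, mul_add, smul_mul_assoc, mul_smul_comm]
  conv_rhs => rw [← one_smul ℂ (_ + _), ← normSq]
  match_scalars <;> simp <;> simp [qi, qj, qk] <;> ring

end FrameIndependence

/-! ### Isotypic parts as Casimir eigenspaces -/

section Invariant

variable {X : Type*} [AddCommGroup X] [Module ℂ X] {I J K : Module.End ℂ X} {W : Submodule ℂ X}

theorem hasEigenvalue_restrict_iff {hI : ∀ w ∈ W, I w ∈ W} {μ : ℂ} :
    Module.End.HasEigenvalue (I.restrict hI) μ ↔ ∃ w ∈ W, w ≠ 0 ∧ I w = μ • w := by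
  refine ⟨fun h => ?_, fun ⟨w, hw, hw0, h⟩ => ?_⟩
  · obtain ⟨w, hw⟩ := h.exists_hasEigenvector
    exact ⟨w, w.2, by simpa using hw.2, congrArg Subtype.val hw.apply_eq_smul⟩
  · exact Module.End.hasEigenvalue_of_hasEigenvector (x := ⟨w, hw⟩)
      ⟨Module.End.mem_eigenspace_iff.2 (Subtype.ext h), by simpa using hw0⟩

theorem IsSu2Triple.restrict (h : IsSu2Triple I J K) (hI : ∀ w ∈ W, I w ∈ W)
    (hJ : ∀ w ∈ W, J w ∈ W) (hK : ∀ w ∈ W, K w ∈ W) :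
    IsSu2Triple (A := Module.End ℂ W) (I.restrict hI) (J.restrict hJ) (K.restrict hK) := by
  constructor <;> ext w
  exacts [LinearMap.congr_fun h.comm_IJ w, LinearMap.congr_fun h.comm_JK w,
    LinearMap.congr_fun h.comm_KI w]

theorem IsSu2Triple.exists_isGreatest_weight_of_invariant [FiniteDimensional ℂ X]
    (h : IsSu2Triple I J K) (hW : W ≠ ⊥) (hI : ∀ w ∈ W, I w ∈ W) (hJ : ∀ w ∈ W, J w ∈ W)
    (hK : ∀ w ∈ W, K w ∈ W) :
    ∃ m : ℕ, IsGreatest {s : ℤ | ∃ w ∈ W, w ≠ 0 ∧ I w = ((s : ℂ) * Complex.I) • w} m ∧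
      W ⊓ (su2Casimir I J K).eigenspace (casimirValue m) ≠ ⊥ := by
  have := Submodule.nontrivial_iff_ne_bot.2 hW
  obtain ⟨m, hm, hc⟩ := (h.restrict hI hJ hK).exists_isGreatest_weight
  simp only [hasEigenvalue_restrict_iff] at hm
  obtain ⟨w, hw⟩ := hc.exists_hasEigenvector
  refine ⟨m, hm, (Submodule.ne_bot_iff _).2 ⟨w, ⟨w.2, ?_⟩, by simpa using hw.2⟩⟩
  exact Module.End.mem_eigenspace_iff.2 (congrArg Subtype.val hw.apply_eq_smul)

end Invariant

section Isotypic

variable {V : Type*} [AddCommGroup V] [Module ℝ V] [TopologicalSpace V]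
  [IsTopologicalAddGroup V] [ContinuousConstSMul ℝ V] {n k : ℕ} {u : HSpace n ≃L[ℝ] V}
  {W : Submodule ℂ (V [⋀^Fin k]→L[ℝ] ℂ)}

variable (u) in
theorem isSubrep_eigenspace_casimir (c : ℂ) :
    IsSubrep (k := k) u (Module.End.eigenspace (casimir u) c) := fun _ hp =>
  Module.End.mapsTo_genEigenspace_of_comm (commute_casimir_sp1Action u hp) c 1

theorem IsSubrep.exists_isGreatest_weights (h : IsSubrep u W) (hW : W ≠ ⊥) :
    ∃ m : ℕ, IsGreatest (weights u W) m ∧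
      W ⊓ Module.End.eigenspace (casimir u) (casimirValue m) ≠ ⊥ :=
  have := finiteDimensional_forms (k := k) u
  (isSu2Triple_sp1Action u).exists_isGreatest_weight_of_invariant hW (h qi rfl) (h qj rfl)
    (h qk rfl)

theorem IsIrredSubrep.le_eigenspace_casimir (h : IsIrredSubrep u W) {r : ℤ}
    (hr : IsGreatest (weights u W) r) :
    W ≤ Module.End.eigenspace (casimir u) (casimirValue r) := by
  obtain ⟨m, hm, hne⟩ := h.1.exists_isGreatest_weights h.2.1
  obtain rfl := hr.unique hm
  exact inf_eq_left.1 <|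
    (h.2.2 _ inf_le_left (h.1.inf (isSubrep_eigenspace_casimir u _))).resolve_left hne

variable (u)

theorem isotypic_le_eigenspace_casimir (r : ℤ) :
    isotypic k r u ≤ Module.End.eigenspace (casimir u) (casimirValue r) :=
  sSup_le fun _ hW => hW.1.le_eigenspace_casimir hW.2

theorem isotypic_of_neg {r : ℤ} (hr : r < 0) : isotypic k r u = ⊥ := by
  refine sSup_eq_bot.2 fun W hW => ?_
  obtain ⟨m, hm, -⟩ := hW.1.1.exists_isGreatest_weights hW.1.2.1
  have := hW.2.unique hm
  lia

theorem isotypic_eq_eigenspace_casimir {r : ℤ} (hr : -1 ≤ r) :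
    isotypic k r u = Module.End.eigenspace (casimir u) (casimirValue r) := by
  refine (isotypic_le_eigenspace_casimir u r).antisymm ?_
  refine (isSubrep_eigenspace_casimir u _).le_sSup_irred.trans (sSup_le_sSup ?_)
  rintro W ⟨hle, hW⟩
  obtain ⟨m, hm, hne⟩ := hW.1.exists_isGreatest_weights hW.2.1
  obtain ⟨w, hw, hw0⟩ := (Submodule.ne_bot_iff _).1 hne
  have value_eq : casimirValue r = casimirValue m := smul_left_injective ℂ hw0 <|
    (Module.End.mem_eigenspace_iff.1 (hle hw.1)).symm.trans (Module.End.mem_eigenspace_iff.1 hw.2)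
  rw [casimirValue_injOn hr (by simp) value_eq]
  exact ⟨hW, hm⟩

theorem iSup_isotypic : ⨆ r : ℤ, isotypic k r u = ⊤ := by
  have isSubrep_top : IsSubrep u (⊤ : Submodule ℂ (V [⋀^Fin k]→L[ℝ] ℂ)) := fun _ _ _ _ => trivial
  refine top_le_iff.1 (isSubrep_top.le_sSup_irred.trans (sSup_le ?_))
  rintro W ⟨-, hW⟩
  obtain ⟨m, hm, -⟩ := hW.1.exists_isGreatest_weights hW.2.1
  exact le_iSup_of_le (m : ℤ) (le_sSup ⟨hW, hm⟩)

theorem iSupIndep_isotypic : iSupIndep fun r : ℤ => isotypic k r u := by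
  intro r
  rcases lt_or_ge r 0 with hr | hr
  · simp [isotypic_of_neg u hr]
  · refine ((Module.End.eigenspaces_iSupIndep (casimir u)) (casimirValue r)).mono
      (isotypic_le_eigenspace_casimir u r) (iSup₂_le fun s hs => ?_)
    rcases lt_or_ge s 0 with hs0 | hs0
    · simp [isotypic_of_neg u hs0]
    · refine (isotypic_le_eigenspace_casimir u s).trans (le_iSup₂_of_le (casimirValue s) ?_ le_rfl)
      exact fun h => hs (casimirValue_injOn (by simp; lia) (by simp; lia) h)

theorem isCompl_isotypic (r : ℤ) :
    IsCompl (isotypic k r u) (⨆ s : {s : ℤ // s ≠ r}, isotypic k s u) where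
  disjoint := by simpa only [iSup_subtype] using iSupIndep_isotypic u r
  codisjoint := by
    rw [codisjoint_iff_le_sup, ← iSup_isotypic u]
    refine iSup_le fun s => ?_
    obtain rfl | hs := eq_or_ne s r
    · exact le_sup_left
    · exact le_sup_of_le_right (le_iSup_of_le ⟨s, hs⟩ le_rfl)

end Isotypic

/-! ### Alternation and the Casimir operator -/

section Su2

variable {A B : Type*} [Ring A] [Ring B]

theorem IsSu2Triple.map {I J K : A} (h : IsSu2Triple I J K) (f : A →+* B) :
    IsSu2Triple (f I) (f J) (f K) := by
  constructor <;> simp only [← map_mul, ← map_sub, h.comm_IJ, h.comm_JK, h.comm_KI] <;>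
    rw [map_mul, map_ofNat]

theorem map_su2Casimir (f : A →+* B) (I J K : A) :
    f (su2Casimir I J K) = su2Casimir (f I) (f J) (f K) := by
  simp only [su2Casimir, map_add, map_mul]

variable {X : Type*} [AddCommGroup X] [Module ℂ X] {I J K : Module.End ℂ X}

theorem IsSu2Triple.su2Casimir_add_basis_apply_apply (h : IsSu2Triple I J K)
    {S : QuaternionAlgebra.Basis (Module.End ℂ X) (-1 : ℤ) 0 (-1)}
    (hS : ∀ x ∈ ({I, J, K} : Set (Module.End ℂ X)),
      ∀ s ∈ ({S.i, S.j, S.k} : Set (Module.End ℂ X)), Commute s x)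
    {r : ℤ} {x : X} (hx : su2Casimir I J K x = casimirValue r • x) :
    let D := su2Casimir (I + S.i) (J + S.j) (K + S.k)
    D (D x) = (casimirValue (r + 1) + casimirValue (r - 1)) • D x -
      (casimirValue (r + 1) * casimirValue (r - 1)) • x := by
  intro D
  have quadratic := LinearMap.congr_fun (h.su2Casimir_add_basis_mul_self hS) x
  simp only [← Nat.cast_ofNat (R := Module.End ℂ X), ← nsmul_eq_mul,
    LinearMap.add_apply, LinearMap.sub_apply, Module.End.mul_apply, LinearMap.smul_apply, hx,
    map_smul, Module.End.natCast_apply] at quadratic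
  refine quadratic.trans ?_
  simp only [casimirValue]
  push_cast
  module

end Su2

section HomAction

variable {E F : Type*} [NormedAddCommGroup E] [NormedSpace ℝ E]
  [NormedAddCommGroup F] [NormedSpace ℂ F] {n : ℕ}

/-- The dual action of an endomorphism of `E` on the first factor of `Hom(E, F) = E* ⊗ F`. -/
def homDual (A : E →L[ℝ] E) : Module.End ℂ (E →L[ℝ] F) where
  toFun ψ := -(ψ ∘L A)
  map_add' _ _ := by ext; simp [add_comm]
  map_smul' _ _ := by ext; simp

theorem homDual_apply (A : E →L[ℝ] E) (ψ : E →L[ℝ] F) (w : E) : homDual A ψ w = -ψ (A w) := rfl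

theorem homDual_quatEnd_mul (u : HSpace n ≃L[ℝ] E) {p q r : ℍ[ℝ]} (h : q * p = -r) :
    homDual (F := F) (quatEnd u p) * homDual (quatEnd u q) = homDual (quatEnd u r) := by
  ext ψ w
  simp [homDual_apply, quatEnd_apply, smul_smul, h]

theorem homDual_quatEnd_mul_self (u : HSpace n ≃L[ℝ] E) {p : ℍ[ℝ]} (h : p * p = -1) :
    homDual (F := F) (quatEnd u p) * homDual (quatEnd u p) = -1 := by
  ext ψ w
  simp [homDual_apply, quatEnd_apply, smul_smul, h]

/-- The dual of the action of the quaternions on `E` given by the frame `u`. Dualizing reverses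
products, and the sign in `homDual` restores the quaternion relations. -/
def homDualBasis (u : HSpace n ≃L[ℝ] E) :
    QuaternionAlgebra.Basis (Module.End ℂ (E →L[ℝ] F)) (-1 : ℤ) 0 (-1) where
  i := homDual (quatEnd u qi)
  j := homDual (quatEnd u qj)
  k := homDual (quatEnd u qk)
  i_mul_i := by
    rw [homDual_quatEnd_mul_self u (by ext <;> simp <;> simp [qi])]
    simp
  j_mul_j := by
    rw [homDual_quatEnd_mul_self u (by ext <;> simp <;> simp [qj])]
    simp
  i_mul_j := homDual_quatEnd_mul u (by ext <;> simp <;> simp [qi, qj, qk])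
  j_mul_i := by
    have qi_mul_qj : qi * qj = qk := by ext <;> simp <;> simp [qi, qj, qk]
    ext ψ w
    simp [homDual_apply, quatEnd_apply, smul_smul, qi_mul_qj]

variable [FiniteDimensional ℝ E]

/-- The action of an endomorphism of `F` on the second factor of `Hom(E, F) = E* ⊗ F`. -/
def homPostcomp : Module.End ℂ F →+* Module.End ℂ (E →L[ℝ] F) where
  toFun T :=
    { toFun := fun ψ => LinearMap.toContinuousLinearMap (T.restrictScalars ℝ ∘ₗ ψ.toLinearMap)
      map_add' := fun _ _ => by ext; simp
      map_smul' := fun _ _ => by ext; simp }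
  map_one' := rfl
  map_mul' _ _ := rfl
  map_zero' := rfl
  map_add' _ _ := rfl

theorem homPostcomp_apply (T : Module.End ℂ F) (ψ : E →L[ℝ] F) (w : E) :
    homPostcomp T ψ w = T (ψ w) := rfl

theorem commute_homDual_homPostcomp (A : E →L[ℝ] E) (T : Module.End ℂ F) :
    Commute (homDual A) (homPostcomp (E := E) T) := by
  ext ψ w
  simp [homPostcomp_apply, homDual_apply]

end HomAction

section Alternation

open ContinuousAlternatingMap (alternatizeUncurryFin alternatizeUncurryFin_add
  alternatizeUncurryFin_smul alternatizeUncurryFin_apply)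

variable {E : Type*} [NormedAddCommGroup E] [NormedSpace ℝ E] {n k : ℕ}

/-- The alternation `E* ⊗ Λᵏ E* → Λᵏ⁺¹ E*` as a complex linear map. -/
def alternation :
    (E →L[ℝ] E [⋀^Fin k]→L[ℝ] ℂ) →ₗ[ℂ] (E [⋀^Fin (k + 1)]→L[ℝ] ℂ) where
  toFun := alternatizeUncurryFin
  map_add' := alternatizeUncurryFin_add
  map_smul' := alternatizeUncurryFin_smul

theorem alternation_apply (ψ : E →L[ℝ] E [⋀^Fin k]→L[ℝ] ℂ) (v : Fin (k + 1) → E) :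
    alternation ψ v = ∑ i : Fin (k + 1), (-1) ^ (i : ℕ) • ψ (v i) (i.removeNth v) :=
  alternatizeUncurryFin_apply ψ v

variable [FiniteDimensional ℝ E]

theorem formAction_alternation (A : E →L[ℝ] E) (ψ : E →L[ℝ] E [⋀^Fin k]→L[ℝ] ℂ) :
    formAction A (alternation ψ) = alternation (homPostcomp (formAction A) ψ + homDual A ψ) := by
  ext v
  simp only [formAction_apply, alternation_apply, add_apply,
    ContinuousAlternatingMap.add_apply, homPostcomp_apply, homDual_apply,
    ContinuousAlternatingMap.neg_apply]
  rw [Finset.sum_comm, ← Finset.sum_neg_distrib]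
  refine Finset.sum_congr rfl fun i _ => ?_
  have update_removed (j : Fin k) :
      ψ (Function.update v (i.succAbove j) (A (v (i.succAbove j))) i)
        (i.removeNth (Function.update v (i.succAbove j) (A (v (i.succAbove j))))) =
      ψ (v i) (Function.update (i.removeNth v) j (A (i.removeNth v j))) := by
    rw [Function.update_of_ne (Fin.succAbove_ne i j).symm, Fin.removeNth_update_succAbove]
    rfl
  rw [Fin.sum_univ_succAbove _ i]
  simp only [update_removed, Function.update_self, Fin.removeNth_update, ← Finset.smul_sum,
    ← smul_add, ← smul_neg]
  congr 1
  abel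

theorem casimir_casimir_alternation (u : HSpace n ≃L[ℝ] E) {r : ℤ}
    {ψ : E →L[ℝ] E [⋀^Fin k]→L[ℝ] ℂ}
    (hψ : ∀ w, ψ w ∈ Module.End.eigenspace (casimir u) (casimirValue r)) :
    casimir u (casimir u (alternation ψ)) =
      (casimirValue (r + 1) + casimirValue (r - 1)) • casimir u (alternation ψ) -
        (casimirValue (r + 1) * casimirValue (r - 1)) • alternation ψ := by
  let ρ := homPostcomp (E := E) (F := E [⋀^Fin k]→L[ℝ] ℂ)
  let S := homDualBasis (F := E [⋀^Fin k]→L[ℝ] ℂ) u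
  have commute : ∀ x ∈ ({ρ (sp1Action u qi), ρ (sp1Action u qj), ρ (sp1Action u qk)} : Set _),
      ∀ s ∈ ({S.i, S.j, S.k} : Set _), Commute s x := by
    rintro _ (rfl | rfl | rfl) _ (rfl | rfl | rfl) <;> exact commute_homDual_homPostcomp _ _
  have casimir_apply : su2Casimir (ρ (sp1Action u qi)) (ρ (sp1Action u qj))
      (ρ (sp1Action u qk)) ψ = casimirValue r • ψ := by
    rw [← map_su2Casimir, ← casimir_eq_su2Casimir]
    ext1 w
    exact Module.End.mem_eigenspace_iff.1 (hψ w)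
  have casimir_alternation (φ : E →L[ℝ] E [⋀^Fin k]→L[ℝ] ℂ) : casimir u (alternation φ) =
      alternation (su2Casimir (ρ (sp1Action u qi) + S.i) (ρ (sp1Action u qj) + S.j)
        (ρ (sp1Action u qk) + S.k) φ) := by
    simp only [casimir, sp1Action, LinearMap.add_apply, LinearMap.comp_apply,
      formAction_alternation, ← map_add]
    rfl
  rw [casimir_alternation, casimir_alternation,
    ((isSu2Triple_sp1Action u).map ρ).su2Casimir_add_basis_apply_apply commute casimir_apply]
  exact (map_sub alternation _ _).trans
    (congrArg₂ _ (map_smul alternation _ _) (map_smul alternation _ _))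

end Alternation

/-! ### Covariant derivatives in a chart -/

section Calculus

variable {E F : Type*} [NormedAddCommGroup E] [NormedSpace ℝ E] [NormedAddCommGroup F]
  [NormedSpace ℝ F] {n k : ℕ}

theorem commute_formAction {A B : E →L[ℝ] E} (h : Commute A B) :
    Commute (formAction (k := k) A) (formAction B) := by
  rw [commute_iff_eq, ← sub_eq_zero, formAction_comm, sub_eq_zero.2 h]
  ext
  simp [formAction_apply]

theorem commute_casimir_formAction_of_isSpGLAlgebra (u : HSpace n ≃L[ℝ] E) {B : E →L[ℝ] E}
    (hB : IsSpGLAlgebra fun v => u.symm (B (u v))) :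
    Commute (casimir (k := k) u) (formAction B) := by
  obtain ⟨p, hp, A, hA⟩ := hB
  have linear_part (v : E) : (B - quatEnd u p) v = u (A (u.symm v)) := by
    rw [_root_.sub_apply, quatEnd_apply, sub_eq_iff_eq_add', ← map_add, ← hA]
    simp
  have commute_quatEnd (q : ℍ[ℝ]) : Commute (quatEnd u q) (B - quatEnd u p) := by
    ext v
    simp only [mul_apply_eq_comp, linear_part, quatEnd_apply, map_smul,
      ContinuousLinearEquiv.symm_apply_apply]
  rw [← add_sub_cancel (quatEnd u p) B, formAction_add]
  exact (commute_casimir_sp1Action u hp).add_right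
    (su2Casimir_commute_of_commute (A := Module.End ℂ (E [⋀^Fin k]→L[ℝ] ℂ))
      (commute_formAction (commute_quatEnd qi)) (commute_formAction (commute_quatEnd qj))
      (commute_formAction (commute_quatEnd qk)))

theorem hasFDerivAt_apply_mem_of_eventually_mem [FiniteDimensional ℝ F] {γ : E → F}
    {γ' : E →L[ℝ] F} {y : E} {W : Submodule ℝ F} (hγ : HasFDerivAt γ γ' y)
    (h : ∀ᶠ z in 𝓝 y, γ z ∈ W) (w : E) : γ' w ∈ W := by
  obtain ⟨W', hW'⟩ := W.exists_isCompl
  let L : F →L[ℝ] W' := LinearMap.toContinuousLinearMap (W'.projectionOnto W hW'.symm)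
  have mem_iff (x : F) : L x = 0 ↔ x ∈ W := Submodule.projectionOnto_apply_eq_zero_iff _
  have L_γ : (L ∘ γ) =ᶠ[𝓝 y] fun _ => 0 := h.mono fun z => (mem_iff (γ z)).2
  exact (mem_iff _).1 (DFunLike.congr_fun ((L.hasFDerivAt.comp y hγ).unique
    ((hasFDerivAt_const 0 y).congr_of_eventuallyEq L_γ)) w)

theorem fderivCompContinuousLinearMap_compContinuousLinearMap (β : E [⋀^Fin k]→L[ℝ] ℂ)
    {u : F →L[ℝ] E} {L : E →L[ℝ] F} (h : Function.RightInverse L u) (S : F →L[ℝ] E) :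
    (β.fderivCompContinuousLinearMap u S).compContinuousLinearMap L = -formAction (S ∘L L) β := by
  ext v
  simp only [ContinuousAlternatingMap.compContinuousLinearMap_apply,
    ContinuousAlternatingMap.fderivCompContinuousLinearMap_apply,
    ContinuousAlternatingMap.neg_apply, formAction_apply, neg_neg]
  congr! with j - i
  rcases eq_or_ne i j with rfl | hij
  · simp
  · simp [hij, h (v i)]

/-- The covariant derivative at `y` of the form `β` for the connection on a vector space whose
Christoffel symbol at `y` is `Γ`. -/
def covDeriv (Γ : E →L[ℝ] E →L[ℝ] E) (β : E → E [⋀^Fin k]→L[ℝ] ℂ) (y : E) :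
    E →L[ℝ] E [⋀^Fin k]→L[ℝ] ℂ :=
  fderiv ℝ β y - (β y).fderivCompContinuousLinearMap (.id ℝ E) ∘L Γ

theorem covDeriv_apply (Γ : E →L[ℝ] E →L[ℝ] E) (β : E → E [⋀^Fin k]→L[ℝ] ℂ) (y w : E) :
    covDeriv Γ β y w = fderiv ℝ β y w + formAction (Γ w) (β y) := by
  have := fderivCompContinuousLinearMap_compContinuousLinearMap (β y)
    (u := .id ℝ E) (L := .id ℝ E) (fun _ => rfl) (Γ w)
  rw [covDeriv, _root_.sub_apply, ContinuousLinearMap.comp_apply, sub_eq_add_neg]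
  exact congrArg (_ + ·) (neg_eq_iff_eq_neg.2 this)

theorem extDeriv_eq_alternation_covDeriv {Γ : E →L[ℝ] E →L[ℝ] E} (hΓ : ∀ v w, Γ v w = Γ w v)
    (β : E → E [⋀^Fin k]→L[ℝ] ℂ) (y : E) : extDeriv β y = alternation (covDeriv Γ β y) := by
  have : alternation ((β y).fderivCompContinuousLinearMap (.id ℝ E) ∘L Γ) = 0 :=
    ContinuousAlternatingMap.alternatizeUncurryFin_fderivCompContinuousLinearMap_eq_zero _ _ hΓ
  exact ((map_sub alternation (fderiv ℝ β y) _).trans ((congrArg _ this).trans (sub_zero _))).symm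

/-- In a moving frame `s`, covariant differentiation is differentiation of the components up to the
connection form of `s`. -/
theorem covDeriv_apply_eq_fderiv_pullback {β : E → E [⋀^Fin k]→L[ℝ] ℂ} {s : E → F →L[ℝ] E}
    {y : E} {u : F ≃L[ℝ] E} (hu : s y = u) (hβ : DifferentiableAt ℝ β y)
    (hs : DifferentiableAt ℝ s y) (Γ : E →L[ℝ] E →L[ℝ] E) (w : E) :
    covDeriv Γ β y w =
      (fderiv ℝ (fun z => (β z).compContinuousLinearMap (s z)) y w).compContinuousLinearMap
          (u.symm : E →L[ℝ] F) +
        formAction (fderiv ℝ s y w ∘L (u.symm : E →L[ℝ] F) + Γ w) (β y) := by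
  have fderiv_pullback :=
    (hβ.hasFDerivAt.continuousAlternatingMapCompContinuousLinearMap hs.hasFDerivAt).fderiv
  have frame_term := fderivCompContinuousLinearMap_compContinuousLinearMap (β y)
    (u := (u : F →L[ℝ] E)) (L := (u.symm : E →L[ℝ] F)) u.apply_symm_apply (fderiv ℝ s y w)
  rw [covDeriv_apply, fderiv_pullback, hu, formAction_add, LinearMap.add_apply, ← add_assoc,
    add_left_inj, ← neg_neg (formAction _ _), ← frame_term, eq_add_neg_iff_add_eq]
  ext v
  simp [Function.comp_def]

theorem covDeriv_mem_eigenspace_casimir {β : E → E [⋀^Fin k]→L[ℝ] ℂ} {s : E → HSpace n →L[ℝ] E}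
    {y : E} {u : HSpace n ≃L[ℝ] E} (hu : s y = u) (hβ : DifferentiableAt ℝ β y)
    (hs : DifferentiableAt ℝ s y) {c : ℂ}
    (hc : ∀ᶠ z in 𝓝 y, (β z).compContinuousLinearMap (s z) ∈
      Module.End.eigenspace (casimir (.refl ℝ (HSpace n))) c)
    {Γ : E →L[ℝ] E →L[ℝ] E}
    (hΓ : ∀ w, IsSpGLAlgebra fun v => u.symm (fderiv ℝ s y w v + Γ w (u v))) (w : E) :
    covDeriv Γ β y w ∈ Module.End.eigenspace (casimir u) c := by
  have := finiteDimensional_forms (k := k) (.refl ℝ (HSpace n))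
  have := FiniteDimensional.complexToReal (HSpace n [⋀^Fin k]→L[ℝ] ℂ)
  have fderiv_mem := hasFDerivAt_apply_mem_of_eventually_mem
    (W := (Module.End.eigenspace (casimir (.refl ℝ (HSpace n))) c).restrictScalars ℝ)
    (hβ.hasFDerivAt.continuousAlternatingMapCompContinuousLinearMap
      hs.hasFDerivAt).differentiableAt.hasFDerivAt hc w
  have β_mem : β y ∈ Module.End.eigenspace (casimir u) c := by
    have := compContinuousLinearMap_mem_eigenspace_casimir (u' := u) (L := (u.symm : E →L[ℝ] _))
      u.symm_apply_apply (hu ▸ hc.self_of_nhds)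
    convert this
    ext v
    simp [Function.comp_def]
  rw [covDeriv_apply_eq_fderiv_pullback hu hβ hs]
  refine add_mem (compContinuousLinearMap_mem_eigenspace_casimir u.symm_apply_apply fderiv_mem)
    (Module.End.mapsTo_genEigenspace_of_comm
      (commute_casimir_formAction_of_isSpGLAlgebra u ?_) c 1 β_mem)
  simpa using hΓ w

end Calculus

section Connection

variable {E : Type*} [NormedAddCommGroup E] [NormedSpace ℝ E] {M : Type*} [TopologicalSpace M]
  [ChartedSpace E M]

/-- The expression of a vector field in the preferred chart at `x`: its pullback by the inverse
chart. -/
def fieldInChart (X : ∀ y : M, TangentSpace 𝓘(ℝ, E) y) (x : M) : E → E :=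
  VectorField.mpullback 𝓘(ℝ, E) 𝓘(ℝ, E) (extChartAt 𝓘(ℝ, E) x).symm X

theorem fieldInChart_eq_mpullbackWithin (X : ∀ y : M, TangentSpace 𝓘(ℝ, E) y) (x : M) :
    fieldInChart X x = VectorField.mpullbackWithin 𝓘(ℝ, E) 𝓘(ℝ, E) (extChartAt 𝓘(ℝ, E) x).symm X
      (Set.range 𝓘(ℝ, E)) := by
  rw [modelWithCornersSelf_coe, Set.range_id, VectorField.mpullbackWithin_univ]
  rfl

theorem fieldInChart_self [IsManifold 𝓘(ℝ, E) 1 M] (X : ∀ y : M, TangentSpace 𝓘(ℝ, E) y) (x : M) :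
    fieldInChart X x (extChartAt 𝓘(ℝ, E) x x) = X x := by
  rw [fieldInChart_eq_mpullbackWithin, VectorField.mpullbackWithin_apply, extChartAt_to_inv]
  exact mfderivWithin_extChartAt_symm_inverse_apply (X x)

theorem mlieBracket_eq_fderiv_sub_fderiv [IsManifold 𝓘(ℝ, E) 1 M]
    (X Y : ∀ y : M, TangentSpace 𝓘(ℝ, E) y) (x : M) :
    VectorField.mlieBracket 𝓘(ℝ, E) X Y x =
      fderiv ℝ (fieldInChart Y x) (extChartAt 𝓘(ℝ, E) x x) (X x) -
        fderiv ℝ (fieldInChart X x) (extChartAt 𝓘(ℝ, E) x x) (Y x) := by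
  rw [VectorField.mlieBracket, VectorField.mlieBracketWithin_apply, mfderiv_extChartAt_self,
    ← fieldInChart_eq_mpullbackWithin, ← fieldInChart_eq_mpullbackWithin,
    modelWithCornersSelf_coe, Set.range_id, Set.preimage_univ, Set.inter_univ,
    VectorField.lieBracketWithin_univ, VectorField.lieBracket, fieldInChart_self,
    fieldInChart_self]
  exact DFunLike.congr_fun (ContinuousLinearMap.inverse_id (R := ℝ) (M := E)) _

variable [CompleteSpace E] [IsManifold 𝓘(ℝ, E) 2 M]

theorem differentiableAt_fieldInChart {X : ∀ y : M, TangentSpace 𝓘(ℝ, E) y} {x : M}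
    (hX : MDiffAt (T% X) x) :
    DifferentiableAt ℝ (fieldInChart X x) (extChartAt 𝓘(ℝ, E) x x) := by
  have := hX.mdifferentiableWithinAt.differentiableWithinAt_mpullbackWithin_vectorField
    (s := Set.univ)
  rw [← fieldInChart_eq_mpullbackWithin, modelWithCornersSelf_coe, Set.range_id, Set.preimage_univ,
    Set.inter_univ] at this
  exact differentiableWithinAt_univ.1 this

/-- The flat connection given at every point by the preferred chart there. -/
def chartConnection (X : ∀ y : M, TangentSpace 𝓘(ℝ, E) y) (x : M) :
    TangentSpace 𝓘(ℝ, E) x →L[ℝ] TangentSpace 𝓘(ℝ, E) x :=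
  (fderiv ℝ (fieldInChart X x) (extChartAt 𝓘(ℝ, E) x x) : E →L[ℝ] E)

theorem isCovariantDerivativeOn_chartConnection :
    IsCovariantDerivativeOn (I := 𝓘(ℝ, E)) E (V := (TangentSpace 𝓘(ℝ, E) : M → Type _))
      chartConnection Set.univ where
  add {X Y x} hX hY _ := by
    have : fieldInChart (X + Y) x = fieldInChart X x + fieldInChart Y x :=
      VectorField.mpullback_add
    rw [chartConnection, this]
    exact fderiv_add (differentiableAt_fieldInChart hX) (differentiableAt_fieldInChart hY)
  leibniz {X g x} hX hg _ := by
    have field_smul : fieldInChart (g • X) x =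
        fun z => g ((extChartAt 𝓘(ℝ, E) x).symm z) • fieldInChart X x z :=
      VectorField.mpullback_smul
    have differentiableAt_g : DifferentiableAt ℝ (fun z => g ((extChartAt 𝓘(ℝ, E) x).symm z))
        (extChartAt 𝓘(ℝ, E) x x) := by
      have := hg.differentiableWithinAt_writtenInExtChartAt
      rwa [ModelWithCorners.range_eq_univ, differentiableWithinAt_univ] at this
    have fderiv_g (w : E) : mvfderiv 𝓘(ℝ, E) g x w =
        fderiv ℝ (fun z => g ((extChartAt 𝓘(ℝ, E) x).symm z)) (extChartAt 𝓘(ℝ, E) x x) w := by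
      have := hg.mfderiv
      rw [ModelWithCorners.range_eq_univ, fderivWithin_univ] at this
      exact DFunLike.congr_fun this w
    have fderiv_smul := fderiv_fun_smul differentiableAt_g (differentiableAt_fieldInChart hX)
    rw [fieldInChart_self, extChartAt_to_inv, ← field_smul] at fderiv_smul
    refine fderiv_smul.trans (ContinuousLinearMap.ext fun w => ?_)
    exact congrArg (fun t : ℝ => g x • chartConnection X x w + t • X x) (fderiv_g w).symm

theorem exists_christoffel [FiniteDimensional ℝ E]
    (cov : CovariantDerivative 𝓘(ℝ, E) E (TangentSpace 𝓘(ℝ, E) : M → Type _)) (x : M) :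
    ∃ Γ : E →L[ℝ] E →L[ℝ] E, ∀ X : ∀ y : M, TangentSpace 𝓘(ℝ, E) y, MDiffAt (T% X) x →
      ∀ w : E, cov X x w =
        fderiv ℝ (fieldInChart X x) (extChartAt 𝓘(ℝ, E) x x) w + Γ (X x) w := by
  refine ⟨IsCovariantDerivativeOn.difference cov.isCovariantDerivativeOnUniv
      isCovariantDerivativeOn_chartConnection x, fun X hX w => ?_⟩
  have := DFunLike.congr_fun (IsCovariantDerivativeOn.difference_apply
    cov.isCovariantDerivativeOnUniv isCovariantDerivativeOn_chartConnection trivial hX) w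
  exact eq_add_of_sub_eq' this.symm

theorem exists_symmetric_christoffel [FiniteDimensional ℝ E]
    {cov : CovariantDerivative 𝓘(ℝ, E) E (TangentSpace 𝓘(ℝ, E) : M → Type _)}
    (hcov : cov.torsion = 0) (x : M) :
    ∃ Γ : E →L[ℝ] E →L[ℝ] E, (∀ v w, Γ v w = Γ w v) ∧
      ∀ X : ∀ y : M, TangentSpace 𝓘(ℝ, E) y, MDiffAt (T% X) x → ∀ w : E, cov X x w =
        fderiv ℝ (fieldInChart X x) (extChartAt 𝓘(ℝ, E) x x) w + Γ w (X x) := by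
  obtain ⟨Γ, hΓ⟩ := exists_christoffel cov x
  have Γ_symm (v w : TangentSpace 𝓘(ℝ, E) x) : Γ v w = Γ w v := by
    have exists_field (v : TangentSpace 𝓘(ℝ, E) x) :
        ∃ X : ∀ y : M, TangentSpace 𝓘(ℝ, E) y, MDiffAt (T% X) x ∧ X x = v :=
      ⟨FiberBundle.extend E v, FiberBundle.mdifferentiableAt_extend ..,
        FiberBundle.extend_apply_self ..⟩
    obtain ⟨X, hX, rfl⟩ := exists_field v
    obtain ⟨Y, hY, rfl⟩ := exists_field w
    have torsion_free := cov.torsion_eq_zero_iff.1 hcov hX hY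
    rw [mlieBracket_eq_fderiv_sub_fderiv, hΓ Y hY (X x), hΓ X hX (Y x)] at torsion_free
    exact (sub_eq_zero.1 (add_eq_left.1 ((add_sub_add_comm ..).symm.trans torsion_free))).symm
  exact ⟨Γ, Γ_symm, fun X hX w => (hΓ X hX w).trans (congrArg _ (Γ_symm _ _))⟩

end Connection

section FrameInChart

theorem differentiableAt_clm_of_apply {E F G : Type*} [NormedAddCommGroup E] [NormedSpace ℝ E]
    [NormedAddCommGroup F] [NormedSpace ℝ F] [FiniteDimensional ℝ F] [NormedAddCommGroup G]
    [NormedSpace ℝ G] {f : E → F →L[ℝ] G} {x : E}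
    (h : ∀ v, DifferentiableAt ℝ (fun z => f z v) x) : DifferentiableAt ℝ f x := by
  let coords : F ≃L[ℝ] (Fin (Module.finrank ℝ F) → ℝ) :=
    .ofFinrankEq (Module.finrank_fin_fun ℝ).symm
  let values := (coords.arrowCongr (.refl ℝ G)).trans (.piRing (Fin (Module.finrank ℝ F)))
  exact values.comp_differentiableAt_iff.1 (differentiableAt_pi.2 fun i => h _)

variable {E : Type*} [NormedAddCommGroup E] [NormedSpace ℝ E] {M : Type*} [TopologicalSpace M]
  [ChartedSpace E M] {F : Type*} [NormedAddCommGroup F] [NormedSpace ℝ F]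

/-- The expression of a field of linear maps `F →L[ℝ] T_y M` in the preferred chart at `x`. -/
def frameInChart (s : ∀ y : M, F →L[ℝ] TangentSpace 𝓘(ℝ, E) y) (x : M) (z : E) : F →L[ℝ] E :=
  (mfderiv 𝓘(ℝ, E) 𝓘(ℝ, E) (extChartAt 𝓘(ℝ, E) x).symm z).inverse ∘L
    s ((extChartAt 𝓘(ℝ, E) x).symm z)

theorem mfderiv_extChartAt_symm_frameInChart_apply [IsManifold 𝓘(ℝ, E) 1 M]
    (s : ∀ y : M, F →L[ℝ] TangentSpace 𝓘(ℝ, E) y) {x : M} {z : E}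
    (hz : z ∈ (extChartAt 𝓘(ℝ, E) x).target) (v : F) :
    mfderiv 𝓘(ℝ, E) 𝓘(ℝ, E) (extChartAt 𝓘(ℝ, E) x).symm z (frameInChart s x z v) =
      s ((extChartAt 𝓘(ℝ, E) x).symm z) v := by
  have := isInvertible_mfderivWithin_extChartAt_symm hz
  rw [ModelWithCorners.range_eq_univ, mfderivWithin_univ] at this
  exact this.self_apply_inverse _

variable [CompleteSpace E] [IsManifold 𝓘(ℝ, E) 2 M] [FiniteDimensional ℝ F]
  {s : ∀ y : M, F →L[ℝ] TangentSpace 𝓘(ℝ, E) y} {x : M}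

theorem differentiableAt_frameInChart (hs : ∀ v, MDiffAt (T% (fun y => s y v)) x) :
    DifferentiableAt ℝ (frameInChart s x) (extChartAt 𝓘(ℝ, E) x x) :=
  differentiableAt_clm_of_apply fun v => differentiableAt_fieldInChart (hs v)

theorem fderiv_frameInChart_apply (hs : ∀ v, MDiffAt (T% (fun y => s y v)) x) (w : E) (v : F) :
    fderiv ℝ (frameInChart s x) (extChartAt 𝓘(ℝ, E) x x) w v =
      fderiv ℝ (fieldInChart (fun y => s y v) x) (extChartAt 𝓘(ℝ, E) x x) w := by
  have := (ContinuousLinearMap.apply ℝ E v).hasFDerivAt.comp (extChartAt 𝓘(ℝ, E) x x)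
    (differentiableAt_frameInChart hs).hasFDerivAt
  exact (DFunLike.congr_fun this.fderiv w).symm

end FrameInChart

section FormInChart

variable {n k : ℕ} {M : Type*} [TopologicalSpace M]
  [ChartedSpace (EuclideanSpace ℝ (Fin (4 * n))) M]

theorem inChart_compContinuousLinearMap_frameInChart [IsManifold (𝓡 (4 * n)) 1 M]
    {F : Type*} [NormedAddCommGroup F] [NormedSpace ℝ F]
    (α : ∀ y : M, Covector n k y) (s : ∀ y : M, F →L[ℝ] TangentSpace (𝓡 (4 * n)) y)
    {x : M} {z : EuclideanSpace ℝ (Fin (4 * n))} (hz : z ∈ (extChartAt (𝓡 (4 * n)) x).target) :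
    (inChart α x z).compContinuousLinearMap (frameInChart s x z) =
      (α ((extChartAt (𝓡 (4 * n)) x).symm z)).compContinuousLinearMap
        (s ((extChartAt (𝓡 (4 * n)) x).symm z)) := by
  ext v
  exact congrArg (α ((extChartAt (𝓡 (4 * n)) x).symm z))
    (funext fun i => mfderiv_extChartAt_symm_frameInChart_apply s hz (v i))

theorem extD_eq_extDeriv [IsManifold (𝓡 (4 * n)) 1 M] (α : ∀ y : M, Covector n k y) (x : M) :
    extD α x = extDeriv (inChart α x) (extChartAt (𝓡 (4 * n)) x x) := by
  ext v
  refine congrArg (extDeriv (inChart α x) (extChartAt (𝓡 (4 * n)) x x)) (funext fun i => ?_)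
  exact DFunLike.congr_fun (mfderiv_extChartAt_self (I := 𝓡 (4 * n)) (x := x)) (v i)

end FormInChart

section FrameIndependence

variable {V : Type*} [AddCommGroup V] [Module ℝ V] [TopologicalSpace V]
  [IsTopologicalAddGroup V] [ContinuousConstSMul ℝ V] {n k : ℕ}

theorem isotypic_trans (u : HSpace n ≃L[ℝ] V) {g : HSpace n ≃L[ℝ] HSpace n} (hg : IsSpGL g)
    (r : ℤ) : isotypic k r (g.trans u) = isotypic k r u := by
  rcases lt_or_ge r 0 with hr | hr
  · rw [isotypic_of_neg u hr, isotypic_of_neg _ hr]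
  · rw [isotypic_eq_eigenspace_casimir u (by lia), isotypic_eq_eigenspace_casimir _ (by lia),
      casimir_trans u hg]

end FrameIndependence

/-! ### `SpGLStructure`s and the exterior derivative -/

theorem IsSmoothFrameOn.mdifferentiableAt {n : ℕ} {M : Type*} [TopologicalSpace M]
    [ChartedSpace (EuclideanSpace ℝ (Fin (4 * n))) M] [IsManifold (𝓡 (4 * n)) ∞ M]
    {s : ∀ y : M, HSpace n ≃L[ℝ] TangentSpace (𝓡 (4 * n)) y} {U : Set M}
    (hs : IsSmoothFrameOn s U) (hU : IsOpen U) {x : M} (hx : x ∈ U) (v : HSpace n) :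
    MDifferentiableAt (𝓡 (4 * n)) (𝓡 (4 * n)).tangent (T% (fun y => s y v)) x :=
  ((hs v).contMDiffAt (hU.mem_nhds hx)).mdifferentiableAt (by simp)

theorem IsSmoothForm.differentiableAt_inChart {n k : ℕ} {M : Type*} [TopologicalSpace M]
    [ChartedSpace (EuclideanSpace ℝ (Fin (4 * n))) M] {α : ∀ x : M, Covector n k x}
    (hα : IsSmoothForm α) (x : M) :
    DifferentiableAt ℝ (inChart α x) (extChartAt (𝓡 (4 * n)) x x) :=
  ((hα x).contDiffAt (extChartAt_target_mem_nhds x)).differentiableAt (by simp)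

theorem sub_smul_mem_eigenspace {R X : Type*} [CommRing R] [AddCommGroup X] [Module R X]
    {T : Module.End R X} {a b : R} {x : X} (h : T (T x) = (a + b) • T x - (a * b) • x) :
    T x - b • x ∈ T.eigenspace a := by
  rw [Module.End.mem_eigenspace_iff, map_sub, map_smul, h]
  module

namespace SpGLStructure

variable {n k : ℕ} {M : Type*} [TopologicalSpace M]
  [ChartedSpace (EuclideanSpace ℝ (Fin (4 * n))) M] [IsManifold (𝓡 (4 * n)) ∞ M]
  (Q : SpGLStructure n M) {x : M} {u : HSpace n ≃L[ℝ] TangentSpace (𝓡 (4 * n)) x}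

theorem E_eq_isotypic (hu : u ∈ Q.frames x) (r : ℤ) : Q.E k r x = isotypic k r u := by
  refine le_antisymm (iInf₂_le u hu) (le_iInf₂ fun u' hu' => ?_)
  obtain ⟨g, hg, rfl⟩ := (Q.mem_frames_iff x u hu u').1 hu'
  exact (isotypic_trans u hg r).ge

theorem E_le_eigenspace_casimir (hu : u ∈ Q.frames x) (r : ℤ) :
    Q.E k r x ≤ Module.End.eigenspace (casimir u) (casimirValue r) :=
  (Q.E_eq_isotypic hu r).trans_le (isotypic_le_eigenspace_casimir u r)

theorem E_eq_eigenspace_casimir (hu : u ∈ Q.frames x) {r : ℤ} (hr : -1 ≤ r) :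
    Q.E k r x = Module.End.eigenspace (casimir u) (casimirValue r) :=
  (Q.E_eq_isotypic hu r).trans (isotypic_eq_eigenspace_casimir u hr)

theorem splits (r : ℤ) (x : M) : Q.Splits k r x := by
  obtain ⟨U, -, hxU, s, hs, -⟩ := Q.exists_section x
  simp only [Splits, Q.E_eq_isotypic (hs x hxU)]
  exact isCompl_isotypic (s x) r

variable {Q}

theorem proj_of_mem {r : ℤ} {β : Covector n k x} (hβ : β ∈ Q.E k r x) : Q.proj k r x β = β := by
  rw [proj, dif_pos (Q.splits r x)]
  exact Submodule.projection_apply_of_mem_left _ hβ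

theorem proj_of_mem_of_ne {r s : ℤ} (hsr : s ≠ r) {β : Covector n k x} (hβ : β ∈ Q.E k s x) :
    Q.proj k r x β = 0 := by
  rw [proj, dif_pos (Q.splits r x)]
  exact Submodule.projection_apply_of_mem_right _
    (Submodule.mem_iSup_of_mem (p := fun s : {s // s ≠ r} => Q.E k s x) ⟨s, hsr⟩ hβ)

theorem IsPreservedBy.exists_symmetric_christoffel_isSpGLAlgebra
    {cov : CovariantDerivative (𝓡 (4 * n)) (EuclideanSpace ℝ (Fin (4 * n)))
      (TangentSpace (𝓡 (4 * n)) : M → Type _)} (hQ : Q.IsPreservedBy cov) (hcov : cov.torsion = 0)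
    (x : M) :
    ∃ Γ : EuclideanSpace ℝ (Fin (4 * n)) →L[ℝ] EuclideanSpace ℝ (Fin (4 * n)) →L[ℝ]
        EuclideanSpace ℝ (Fin (4 * n)), (∀ v w, Γ v w = Γ w v) ∧
      ∀ (U : Set M) (s : ∀ y : M, HSpace n ≃L[ℝ] TangentSpace (𝓡 (4 * n)) y), IsOpen U →
        (∀ y ∈ U, s y ∈ Q.frames y) → IsSmoothFrameOn s U → x ∈ U →
        ∀ w, IsSpGLAlgebra fun v => (s x).symm
          (fderiv ℝ (frameInChart (fun y => (s y : HSpace n →L[ℝ] _)) x)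
            (extChartAt (𝓡 (4 * n)) x x) w v + Γ w (s x v)) := by
  obtain ⟨Γ, Γ_symm, hΓ⟩ := exists_symmetric_christoffel hcov x
  refine ⟨Γ, Γ_symm, fun U s hU hs hs_smooth hx w => ?_⟩
  have hs_diff (v : HSpace n) := hs_smooth.mdifferentiableAt hU hx v
  convert hQ U s hU hs hs_smooth x hx w using 3 with v
  have := fderiv_frameInChart_apply (s := fun y => (s y : HSpace n →L[ℝ] _)) hs_diff w v
  exact congrArg (s x).symm ((congrArg (· + Γ w (s x v)) this).trans (hΓ _ (hs_diff v) w).symm)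

theorem exists_symmetric_covDeriv_mem_eigenspace_casimir
    {cov : CovariantDerivative (𝓡 (4 * n)) (EuclideanSpace ℝ (Fin (4 * n)))
      (TangentSpace (𝓡 (4 * n)) : M → Type _)} (hcov : cov.torsion = 0) (hQ : Q.IsPreservedBy cov)
    {α : ∀ y : M, Covector n k y}
    (hα : DifferentiableAt ℝ (inChart α x) (extChartAt (𝓡 (4 * n)) x x)) {r : ℤ}
    (hαr : ∀ᶠ y in 𝓝 x, α y ∈ Q.E k r y) (hu : u ∈ Q.frames x) :
    ∃ Γ : EuclideanSpace ℝ (Fin (4 * n)) →L[ℝ] EuclideanSpace ℝ (Fin (4 * n)) →L[ℝ]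
        EuclideanSpace ℝ (Fin (4 * n)), (∀ v w, Γ v w = Γ w v) ∧
      ∀ w, covDeriv Γ (inChart α x) (extChartAt (𝓡 (4 * n)) x x) w ∈
        Module.End.eigenspace (casimir u) (casimirValue r) := by
  obtain ⟨Γ, Γ_symm, hΓ⟩ := hQ.exists_symmetric_christoffel_isSpGLAlgebra hcov x
  obtain ⟨U, hU, hx, s, hs, hs_smooth⟩ := Q.exists_section x
  obtain ⟨g, hg, rfl⟩ := (Q.mem_frames_iff x (s x) (hs x hx) u).1 hu
  refine ⟨Γ, Γ_symm, fun w => ?_⟩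
  rw [casimir_trans (s x) hg]
  let s' (y : M) : HSpace n →L[ℝ] TangentSpace (𝓡 (4 * n)) y := s y
  have s'_self : frameInChart s' x (extChartAt (𝓡 (4 * n)) x x) = s' x :=
    ContinuousLinearMap.ext fun v => fieldInChart_self (fun y => s y v) x
  have pullback_mem : ∀ᶠ z in 𝓝 (extChartAt (𝓡 (4 * n)) x x),
      (inChart α x z).compContinuousLinearMap (frameInChart s' x z) ∈
        Module.End.eigenspace (casimir (.refl ℝ (HSpace n))) (casimirValue r) := by
    have symm_tendsto := continuousAt_extChartAt_symm (I := 𝓡 (4 * n)) x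
    rw [ContinuousAt, extChartAt_to_inv] at symm_tendsto
    filter_upwards [extChartAt_target_mem_nhds x, symm_tendsto.eventually (hU.mem_nhds hx),
      symm_tendsto.eventually hαr] with z hz hzU hzα
    rw [inChart_compContinuousLinearMap_frameInChart α s' hz]
    exact compContinuousLinearMap_mem_eigenspace_casimir (fun _ => rfl)
      (Q.E_le_eigenspace_casimir (hs _ hzU) r hzα)
  have s'_diff : DifferentiableAt ℝ (frameInChart s' x) (extChartAt (𝓡 (4 * n)) x x) :=
    differentiableAt_frameInChart (hs_smooth.mdifferentiableAt hU hx)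
  exact covDeriv_mem_eigenspace_casimir (E := EuclideanSpace ℝ (Fin (4 * n))) (u := s x)
    (s := frameInChart s' x) s'_self hα s'_diff pullback_mem (hΓ U s hU hs hs_smooth hx) w

theorem casimir_casimir_extD
    {cov : CovariantDerivative (𝓡 (4 * n)) (EuclideanSpace ℝ (Fin (4 * n)))
      (TangentSpace (𝓡 (4 * n)) : M → Type _)} (hcov : cov.torsion = 0) (hQ : Q.IsPreservedBy cov)
    {α : ∀ y : M, Covector n k y}
    (hα : DifferentiableAt ℝ (inChart α x) (extChartAt (𝓡 (4 * n)) x x)) {r : ℤ}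
    (hαr : ∀ᶠ y in 𝓝 x, α y ∈ Q.E k r y) (hu : u ∈ Q.frames x) :
    casimir u (casimir u (extD α x)) =
      (casimirValue (r + 1) + casimirValue (r - 1)) • casimir u (extD α x) -
        (casimirValue (r + 1) * casimirValue (r - 1)) • extD α x := by
  obtain ⟨Γ, Γ_symm, hΓ⟩ := exists_symmetric_covDeriv_mem_eigenspace_casimir hcov hQ hα hαr hu
  rw [extD_eq_extDeriv, extDeriv_eq_alternation_covDeriv Γ_symm]
  exact casimir_casimir_alternation (E := EuclideanSpace ℝ (Fin (4 * n))) u hΓ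

theorem proj_eq_of_casimir_casimir (hu : u ∈ Q.frames x) {r : ℕ} {η : Covector n k x}
    (h : casimir u (casimir u η) =
      (casimirValue (r + 1) + casimirValue (r - 1)) • casimir u η -
        (casimirValue (r + 1) * casimirValue (r - 1)) • η) :
    Q.proj k (r + 1) x η = -(1 / 4 : ℂ) •
        (((r : ℂ) - 1) • η + (1 / ((r : ℂ) + 1)) • casimir u η) ∧
      Q.proj k (r - 1) x η = (1 / 4 : ℂ) •
        (((r : ℂ) + 3) • η + (1 / ((r : ℂ) + 1)) • casimir u η) := by
  have hr : (r : ℂ) + 1 ≠ 0 := by exact_mod_cast r.succ_ne_zero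
  set upper := -(1 / 4 : ℂ) • (((r : ℂ) - 1) • η + (1 / ((r : ℂ) + 1)) • casimir u η)
    with upper_def
  set lower := (1 / 4 : ℂ) • (((r : ℂ) + 3) • η + (1 / ((r : ℂ) + 1)) • casimir u η)
    with lower_def
  have upper_mem : upper ∈ Q.E k (r + 1) x := by
    rw [Q.E_eq_eigenspace_casimir hu (by lia)]
    convert Submodule.smul_mem _ (-(1 / (4 * ((r : ℂ) + 1)))) (sub_smul_mem_eigenspace h) using 1
    rw [upper_def, casimirValue]
    push_cast
    match_scalars <;> field_simp
    ring
  have lower_mem : lower ∈ Q.E k (r - 1) x := by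
    rw [Q.E_eq_eigenspace_casimir hu (by lia)]
    rw [add_comm (casimirValue _), mul_comm (casimirValue _)] at h
    convert Submodule.smul_mem _ (1 / (4 * ((r : ℂ) + 1))) (sub_smul_mem_eigenspace h) using 1
    rw [lower_def, casimirValue]
    push_cast
    match_scalars <;> field_simp
    ring
  have upper_add_lower : upper + lower = η := by
    rw [upper_def, lower_def]
    module
  rw [← upper_add_lower, map_add, map_add, proj_of_mem upper_mem, proj_of_mem lower_mem,
    proj_of_mem_of_ne (by lia) upper_mem, proj_of_mem_of_ne (by lia) lower_mem]
  exact ⟨add_zero _, zero_add _⟩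

end SpGLStructure

end QuaternionicForms

end

theorem lemma4p7_general {n : ℕ} {M : Type*} [TopologicalSpace M]
    [ChartedSpace (EuclideanSpace ℝ (Fin (4 * n))) M] [IsManifold (𝓡 (4 * n)) ∞ M]
    (Q : QuaternionicForms.SpGLStructure n M)
    (cov : CovariantDerivative (𝓡 (4 * n)) (EuclideanSpace ℝ (Fin (4 * n)))
      (TangentSpace (𝓡 (4 * n)) : M → Type _))
    (hcov : cov.torsion = 0) (hQ : Q.IsPreservedBy cov) (k r : ℕ)
    (α : ∀ x : M, QuaternionicForms.Covector n k x) (x : M)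
    (hα : DifferentiableAt ℝ (QuaternionicForms.inChart α x) (extChartAt (𝓡 (4 * n)) x x))
    (hαr : ∀ᶠ y in 𝓝 x, α y ∈ Q.E k r y) :
    (∀ s : ℤ, Q.Splits (k + 1) s x) ∧ ∀ u ∈ Q.frames x,
      Q.D r α x = -(1 / 4 : ℂ) •
        (((r : ℂ) - 1) • QuaternionicForms.extD α x +
          (1 / ((r : ℂ) + 1)) • QuaternionicForms.casimir u (QuaternionicForms.extD α x)) ∧
      Q.Dbar r α x = (1 / 4 : ℂ) •
        (((r : ℂ) + 3) • QuaternionicForms.extD α x +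
          (1 / ((r : ℂ) + 1)) • QuaternionicForms.casimir u (QuaternionicForms.extD α x)) :=
  ⟨fun s => Q.splits s x, fun _ hu => QuaternionicForms.SpGLStructure.proj_eq_of_casimir_casimir hu
    (QuaternionicForms.SpGLStructure.casimir_casimir_extD hcov hQ hα hαr hu)⟩

theorem lemma4p7 {n : ℕ} {M : Type*} [TopologicalSpace M]
    [ChartedSpace (EuclideanSpace ℝ (Fin (4 * n))) M] [IsManifold (𝓡 (4 * n)) ∞ M]
    (Q : QuaternionicForms.SpGLStructure n M) (hQ : Q.IsQuaternionic)
    (k r : ℕ) (α : ∀ x : M, QuaternionicForms.Covector n k x)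
    (hα : Q.IsSmoothSection k r α) :
    -- the projections that define the two operators are honest projections
    (∀ (x : M) (s : ℤ), Q.Splits (k + 1) s x) ∧
    -- the formulas, with the Casimir operator computed in any frame of the structure
    ∀ (x : M), ∀ u ∈ Q.frames x,
      Q.D r α x = -(1 / 4 : ℂ) •
        (((r : ℂ) - 1) • QuaternionicForms.extD α x +
          (1 / ((r : ℂ) + 1)) • QuaternionicForms.casimir u (QuaternionicForms.extD α x)) ∧
      Q.Dbar r α x = (1 / 4 : ℂ) •
        (((r : ℂ) + 3) • QuaternionicForms.extD α x +
          (1 / ((r : ℂ) + 1)) • QuaternionicForms.casimir u (QuaternionicForms.extD α x)) := by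
  obtain ⟨cov, -, hcov, hQ⟩ := hQ
  exact forall_and.1 fun x => lemma4p7_general Q cov hcov hQ k r α x
    (hα.1.differentiableAt_inChart x) (.of_forall hα.2)
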